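/- Let $m_0,\widetilde{m_0}:\mathbb{R}^2\to\mathbb{C}$ be trigonometric polynomials, i.e. finite sums $\sum_{\mathbf k\in\mathbb{Z}^2}c_{\mathbf k}e^{-i\omega\cdot\mathbf k}$, with $m_0(0)=\widetilde{m_0}(0)=1$, and let $\mathbf{D}=\begin{pmatrix}2&0\\0&2\end{pmatrix}$. Let $\phi,\widetilde\phi\in L^2(\mathbb{R}^2)$ be the functions they generate, that is, for almost every $\omega$, $$\widehat\phi(\omega)=(2\pi)^{-1}\prod_{k=1}^\infty m_0(\mathbf{D}^{-k}\omega),\qquad \widehat{\widetilde\phi}(\omega)=(2\pi)^{-1}\prod_{k=1}^\infty \widetilde{m_0}(\mathbf{D}^{-k}\omega),$$ where $\widehat f(\omega)=(2\pi)^{-1}\int_{\mathbb{R}^2} f(x)e^{-i\omega\cdot x}\,dx$, extended to $L^2(\mathbb{R}^2)$ by Plancherel (it is assumed that both products do define functions of $L^2(\mathbb{R}^2)$). Let $S_0=[-\pi,\pi)\times[-\pi,\pi)$ and $\Gamma_0=\{(0,0),(\pi,0),(0,\pi),(\pi,\pi)\}$. The integer translates of $\phi$ and $\widetilde\phi$ are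 called biorthogonal if $\langle\phi(\cdot-\mathbf k),\widetilde\phi(\cdot-\mathbf k')\rangle=\delta_{\mathbf k,\mathbf k'}$ for all $\mathbf k,\mathbf k'\in\mathbb{Z}^2$. For $K\subset\mathbb{R}^2$ consider the conditions (a) $K$ contains a neighborhood of $0$; (b) for every $\omega\in S_0$ there is $\mathbf n\in\mathbb{Z}^2$ with $\omega+2\pi\mathbf n\in K$; (c) $\displaystyle\inf_{k>0,\ \omega\in K}|m_0(\mathbf{D}^{-k}\omega)|>0$ and $\displaystyle\inf_{k>0,\ \omega\in K}|\widetilde{m_0}(\mathbf{D}^{-k}\omega)|>0$. 1. If the integer translates of $\phi$ and $\widetilde\phi$ are biorthogonal, then there is a compact set $K$ with (a), (b), (c) whose area equals that of $S_0$ (so that $K$ is congruent to $S_0$ modulo $2\pi\mathbb{Z}^2$). 2. Conversely, if $\sum_{\boldsymbol\pi\in\Gamma_0}m_0(\omega+\boldsymbol\pi)\,\overline{\widetilde{m_0}(\omega+\boldsymbol\pi)}=1$ for all $\omega\in\mathbb{R}^2$, and some set $K\subset\mathbb{R}^2$ (not necessarily compact, nor of the same area as $S_0$) satisfies (a), (b),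 (c), then the integer translates of $\phi$ and $\widetilde\phi$ are biorthogonal. -/

import Mathlib

open MeasureTheory Topology
open scoped ComplexConjugate FourierTransform ENNReal

noncomputable section

/-- The plane `ℝ²` with its Euclidean structure (both the space and the frequency domain). -/
abbrev Plane : Type := EuclideanSpace ℝ (Fin 2)

/-- The vector of `ℝ²` given by a lattice point of `ℤ²`. -/
def latticeVec (n : Fin 2 → ℤ) : Plane := WithLp.toLp 2 fun i => (n i : ℝ)

/-- Trigonometric polynomials `m(ω) = ∑ₖ cₖ e^{-i ω·k}`, a finite sum over `k ∈ ℤ²`. -/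
def IsTrigPolynomial (m : Plane → ℂ) : Prop :=
  ∃ c : (Fin 2 → ℤ) →₀ ℂ, ∀ ω : Plane,
    m ω = c.sum fun k a => a * Complex.exp (-Complex.I * ((∑ i, ω i * (k i : ℝ) : ℝ) : ℂ))

/-- `D⁻ᵏ ω` for the dilation matrix `D = diag(2, 2)`. -/
def dilateInv (k : ℕ) (ω : Plane) : Plane := ((2 : ℝ)⁻¹ ^ k) • ω

/-- The function `(2π)⁻¹ ∏_{k ≥ 1} m(D⁻ᵏ ω)`. -/
def scalingHat (m : Plane → ℂ) (ω : Plane) : ℂ :=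
  ((2 * Real.pi)⁻¹ : ℝ) * ∏' k : ℕ, m (dilateInv (k + 1) ω)

/-- `φ ∈ L²(ℝ²)` is generated by `m`: its Fourier transform
`φ̂(ω) = (2π)⁻¹ ∫ φ(x) e^{-i ω·x} dx` (in the sense of Plancherel) is
`(2π)⁻¹ ∏_{k ≥ 1} m(D⁻ᵏ ω)` for almost every `ω`.  Mathlib's transform is
`𝓕 φ(ξ) = ∫ φ(x) e^{-2π i ξ·x} dx`, so `φ̂(ω) = (2π)⁻¹ 𝓕 φ(ω / 2π)`. -/
def HasRefinementMask (φ : Lp ℂ 2 (volume : Measure Plane)) (m : Plane → ℂ) : Prop :=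
  ∀ᵐ ω : Plane,
    ((2 * Real.pi)⁻¹ : ℝ) * (𝓕 φ : Lp ℂ 2 (volume : Measure Plane)) ((2 * Real.pi)⁻¹ • ω)
      = scalingHat m ω

/-- Biorthogonality of the integer translates:
`⟨φ(· - k), φ'(· - k')⟩ = δ_{k,k'}` in `L²(ℝ²)`. -/
def BiorthogonalTranslates (φ φ' : Lp ℂ 2 (volume : Measure Plane)) : Prop :=
  ∀ k k' : Fin 2 → ℤ,
    ∫ x : Plane, φ (x - latticeVec k) * conj (φ' (x - latticeVec k'))
      = if k = k' then 1 else 0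

/-- The frequency square `S₀ = [-π, π) × [-π, π)`. -/
def freqSquare : Set Plane := {ω | ∀ i, -Real.pi ≤ ω i ∧ ω i < Real.pi}

/-- Every point of `S₀` has a translate by a vector of `2πℤ²` that lies in `K`. -/
def CoversFreqSquare (K : Set Plane) : Prop :=
  ∀ ω ∈ freqSquare, ∃ n : Fin 2 → ℤ, ω + (2 * Real.pi) • latticeVec n ∈ K

/-- `K` is congruent to `S₀` modulo `2πℤ²`: it covers `S₀` modulo `2πℤ²` and has the same area
(so the covering is one-to-one up to a null set). -/
def CongruentToFreqSquare (K : Set Plane) : Prop :=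
  CoversFreqSquare K ∧ volume K = volume freqSquare

/-- `inf_{k > 0, ω ∈ K} |m(D⁻ᵏ ω)| > 0`. -/
def PosInfOn (m : Plane → ℂ) (K : Set Plane) : Prop :=
  0 < ⨅ p : ℕ+ × K, ‖m (dilateInv (p.1 : ℕ) (p.2 : Plane))‖

open Classical in
/-- The set of shifts `Γ₀ = {(0,0), (π,0), (0,π), (π,π)}`. -/
def shiftSet : Finset Plane :=
  {!₂[0, 0], !₂[Real.pi, 0], !₂[0, Real.pi], !₂[Real.pi, Real.pi]}

end

/-! In the variable ξ = ω/2π the masks become ℤ²-periodic trigonometric polynomials M, M′, and φ, φ̃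
have Fourier transforms H = ∏ M(2⁻ʲξ) and H′ = ∏ M′(2⁻ʲξ), continuous with value 1 at 0. By
Plancherel, biorthogonality says that ∫ H·conj H′·e^{-2πi k·ξ} = δ_{k,0}
(`biorthogonalTranslates_iff`). Both implications pass through one property: every coset ξ + ℤ²
meets the open set U = {H·H′ ≠ 0}. Given this, `exists_compact_fundamentalDomain` cuts out of U a
compact fundamental domain K that is a neighbourhood of 0.

From biorthogonality to K: the bracket ∑ₙ (H·conj H′)(ξ + n) has the Fourier coefficients of 1. It
must equal 1 at every ξ, not just almost everywhere, so its continuity is needed. All partial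
products have frequencies in one ball, hence H = H ∗ η for a Schwartz function η; with H ∈ L² this
gives locally uniform square summability over cosets (`exists_summable_bound_of_reproducing`,
`tsum_mul_conj_eq_one`). So the coset property holds, and a lower bound for |H| on K becomes one for
the factors M(2⁻ᵏξ) (`posInfOn_two_pi_smul`).

From K to biorthogonality: conditions (b) and (c) give the coset property, and the given K is
replaced by a compact one of area one. Products truncated after N factors and cut off to 2ᴺK have
exactly the correlations δ_{k,0}, since the identity over Γ₀ makes each transfer step preserve mean
values (`integral_indicator_partialMask`). They are dominated by |H·H′|/c with c = min |H·H′| on K,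
so the correlations pass to the limit (`integral_infiniteMask_mul_conj`). -/

/-! ### Exponentials and trigonometric polynomials. -/

/-- The exponential `ξ ↦ e^{-2πi x·ξ}` of frequency `-x`. -/
noncomputable def planeWave (x ξ : Plane) : ℂ := (Real.fourierChar (-inner ℝ x ξ) : ℂ)

lemma planeWave_eq_exp (x ξ : Plane) :
    planeWave x ξ = Complex.exp (2 * Real.pi * (-inner ℝ x ξ : ℝ) * Complex.I) := by
  rw [planeWave, Real.fourierChar_apply]; push_cast; rfl

@[simp] lemma norm_planeWave (x ξ : Plane) : ‖planeWave x ξ‖ = 1 := Circle.norm_coe _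

@[simp] lemma planeWave_zero_left (ξ : Plane) : planeWave 0 ξ = 1 := by simp [planeWave]

@[simp] lemma planeWave_zero_right (x : Plane) : planeWave x 0 = 1 := by simp [planeWave]

lemma planeWave_add_left (x y ξ : Plane) : planeWave (x + y) ξ = planeWave x ξ * planeWave y ξ := by
  simp only [planeWave, inner_add_left, neg_add, AddChar.map_add_eq_mul, Circle.coe_mul]

lemma planeWave_add_right (x ξ ζ : Plane) : planeWave x (ξ + ζ) = planeWave x ξ * planeWave x ζ := by
  simp only [planeWave, inner_add_right, neg_add, AddChar.map_add_eq_mul, Circle.coe_mul]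

lemma planeWave_neg_left (x ξ : Plane) : planeWave (-x) ξ = conj (planeWave x ξ) := by
  simp only [planeWave, inner_neg_left, ← Circle.coe_inv_eq_conj, ← AddChar.map_neg_eq_inv]

lemma planeWave_smul_right (x ξ : Plane) (c : ℝ) : planeWave x (c • ξ) = planeWave (c • x) ξ := by
  simp only [planeWave, inner_smul_left, inner_smul_right, conj_trivial]

@[fun_prop] lemma continuous_planeWave (x : Plane) : Continuous (planeWave x) := by
  unfold planeWave; fun_prop

@[simp] lemma latticeVec_zero : latticeVec 0 = 0 := by ext i; simp [latticeVec]

lemma latticeVec_add (m n : Fin 2 → ℤ) : latticeVec (m + n) = latticeVec m + latticeVec n := by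
  ext i; simp [latticeVec]

lemma latticeVec_neg (n : Fin 2 → ℤ) : latticeVec (-n) = -latticeVec n := by
  ext i; simp [latticeVec]

lemma latticeVec_sub (m n : Fin 2 → ℤ) : latticeVec (m - n) = latticeVec m - latticeVec n := by
  ext i; simp [latticeVec]

lemma natCast_smul_latticeVec (a : ℕ) (n : Fin 2 → ℤ) :
    (a : ℝ) • latticeVec n = latticeVec ((a : ℤ) • n) := by
  ext i; simp [latticeVec]

@[simp] lemma planeWave_lattice (k n : Fin 2 → ℤ) : planeWave (latticeVec k) (latticeVec n) = 1 := by
  rw [planeWave_eq_exp]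
  have : (inner ℝ (latticeVec k) (latticeVec n) : ℝ) = ((k 0 * n 0 + k 1 * n 1 : ℤ) : ℝ) := by
    simp [PiLp.inner_apply, latticeVec, Fin.sum_univ_two, mul_comm]
  rw [this, Complex.exp_eq_one_iff]
  exact ⟨-(k 0 * n 0 + k 1 * n 1), by push_cast; ring⟩

lemma norm_planeWave_sub_one_le (x ξ : Plane) :
    ‖planeWave x ξ - 1‖ ≤ 2 * Real.pi * ‖x‖ * ‖ξ‖ := by
  have h := Real.norm_exp_I_mul_ofReal_sub_one_le (x := 2 * Real.pi * (-inner ℝ x ξ : ℝ))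
  rw [planeWave_eq_exp]
  have e : (2 * Real.pi * (-inner ℝ x ξ : ℝ) * Complex.I : ℂ)
      = Complex.I * ((2 * Real.pi * (-inner ℝ x ξ : ℝ) : ℝ) : ℂ) := by push_cast; ring
  rw [e]
  refine h.trans ?_
  rw [norm_mul, norm_mul, norm_neg, mul_assoc (2 * Real.pi)]
  have := abs_real_inner_le_norm x ξ
  simp only [Real.norm_eq_abs, abs_of_pos Real.pi_pos, abs_two]
  gcongr

/-- The span of the exponentials `planeWave x`, `x ∈ X`. -/
def trigSpan (X : Set Plane) : Submodule ℂ (Plane → ℂ) := Submodule.span ℂ (planeWave '' X)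

lemma planeWave_mem_trigSpan {X : Set Plane} {x : Plane} (hx : x ∈ X) : planeWave x ∈ trigSpan X :=
  Submodule.subset_span ⟨x, hx, rfl⟩

lemma trigSpan_mono {X Y : Set Plane} (h : X ⊆ Y) : trigSpan X ≤ trigSpan Y :=
  Submodule.span_mono (Set.image_mono h)

lemma trigSpan_induction {X : Set Plane} {p : (Plane → ℂ) → Prop}
    (hchar : ∀ x ∈ X, p (planeWave x)) (hzero : p 0) (hadd : ∀ f g, p f → p g → p (f + g))
    (hsmul : ∀ (c : ℂ) f, p f → p (c • f)) {f : Plane → ℂ} (hf : f ∈ trigSpan X) : p f := by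
  induction hf using Submodule.span_induction with
  | mem f hf => obtain ⟨x, hx, rfl⟩ := hf; exact hchar x hx
  | zero => exact hzero
  | add f g _ _ hf hg => exact hadd f g hf hg
  | smul c f _ hf => exact hsmul c f hf

lemma trigSpan_mul {X Y Z : Set Plane} (hXY : ∀ x ∈ X, ∀ y ∈ Y, x + y ∈ Z) {f g : Plane → ℂ}
    (hf : f ∈ trigSpan X) (hg : g ∈ trigSpan Y) : f * g ∈ trigSpan Z := by
  refine trigSpan_induction (p := fun f => f * g ∈ trigSpan Z) (fun x hx => ?_) ?_ ?_ ?_ hf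
  · refine trigSpan_induction (p := fun g => planeWave x * g ∈ trigSpan Z)
      (fun y hy => ?_) ?_ ?_ ?_ hg
    · convert planeWave_mem_trigSpan (hXY x hx y hy) using 1
      funext ξ; simp [planeWave_add_left]
    · simp
    · intro f g hf hg; rw [mul_add]; exact add_mem hf hg
    · intro c f hf; rw [mul_smul_comm]; exact Submodule.smul_mem _ _ hf
  · simp
  · intro f g hf hg; rw [add_mul]; exact add_mem hf hg
  · intro c f hf; rw [smul_mul_assoc]; exact Submodule.smul_mem _ _ hf

lemma trigSpan_conj {X : Set Plane} {f : Plane → ℂ} (hf : f ∈ trigSpan X) :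
    (fun ξ => conj (f ξ)) ∈ trigSpan (-X) := by
  refine trigSpan_induction (p := fun f : Plane → ℂ => (fun ξ => conj (f ξ)) ∈ trigSpan (-X))
    (fun x hx => ?_) ?_ ?_ ?_ hf
  · convert planeWave_mem_trigSpan (X := -X) (x := -x) (by simpa using hx) using 1
    funext ξ; rw [planeWave_neg_left]
  · simp only [Pi.zero_apply, map_zero]; exact (trigSpan (-X)).zero_mem
  · intro f g hf hg; simpa using! add_mem hf hg
  · intro c f hf; simpa using! Submodule.smul_mem _ (conj c) hf

lemma trigSpan_comp_smul {X Y : Set Plane} {c : ℝ} (hXY : ∀ x ∈ X, c • x ∈ Y) {f : Plane → ℂ}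
    (hf : f ∈ trigSpan X) : (fun ξ => f (c • ξ)) ∈ trigSpan Y := by
  refine trigSpan_induction (p := fun f : Plane → ℂ => (fun ξ => f (c • ξ)) ∈ trigSpan Y)
    (fun x hx => ?_) ?_ ?_ ?_ hf
  · convert planeWave_mem_trigSpan (hXY x hx) using 1
    funext ξ; rw [planeWave_smul_right]
  · exact (trigSpan Y).zero_mem
  · intro f g hf hg; simpa using! add_mem hf hg
  · intro a f hf; simpa using! Submodule.smul_mem _ a hf

lemma continuous_of_mem_trigSpan {X : Set Plane} {f : Plane → ℂ} (hf : f ∈ trigSpan X) :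
    Continuous f :=
  trigSpan_induction (p := Continuous) (fun x _ => continuous_planeWave x) continuous_zero
    (fun _ _ hf hg => hf.add hg) (fun c _ hf => hf.const_smul c) hf

lemma bounded_of_mem_trigSpan {X : Set Plane} {f : Plane → ℂ} (hf : f ∈ trigSpan X) :
    ∃ B, ∀ ξ, ‖f ξ‖ ≤ B := by
  refine trigSpan_induction (p := fun f : Plane → ℂ => ∃ B, ∀ ξ, ‖f ξ‖ ≤ B)
    (fun x _ => ⟨1, fun ξ => (norm_planeWave x ξ).le⟩) ⟨0, by simp⟩ ?_ ?_ hf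
  · rintro f g ⟨A, hA⟩ ⟨B, hB⟩
    exact ⟨A + B, fun ξ => (norm_add_le _ _).trans (add_le_add (hA ξ) (hB ξ))⟩
  · rintro c f ⟨A, hA⟩
    exact ⟨‖c‖ * A, fun ξ => by
      rw [Pi.smul_apply, norm_smul]; exact mul_le_mul_of_nonneg_left (hA ξ) (norm_nonneg c)⟩

/-- With f 0 = 1 this yields |f(2⁻ʲξ) − 1| ≤ L·2⁻ʲ|ξ|, the geometric decay behind the convergence of
the infinite products. -/
lemma lipschitz_at_zero_of_mem_trigSpan {X : Set Plane} {f : Plane → ℂ} (hf : f ∈ trigSpan X) :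
    ∃ L, 0 ≤ L ∧ ∀ ξ, ‖f ξ - f 0‖ ≤ L * ‖ξ‖ := by
  refine trigSpan_induction (p := fun f : Plane → ℂ => ∃ L, 0 ≤ L ∧ ∀ ξ, ‖f ξ - f 0‖ ≤ L * ‖ξ‖)
    (fun x _ => ⟨2 * Real.pi * ‖x‖, by positivity, fun ξ => ?_⟩) ⟨0, by simp⟩ ?_ ?_ hf
  · rw [planeWave_zero_right]; exact norm_planeWave_sub_one_le x ξ
  · rintro f g ⟨A, hA0, hA⟩ ⟨B, hB0, hB⟩
    refine ⟨A + B, by positivity, fun ξ => ?_⟩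
    rw [Pi.add_apply, Pi.add_apply, add_sub_add_comm, add_mul]
    exact (norm_add_le _ _).trans (add_le_add (hA ξ) (hB ξ))
  · rintro c f ⟨A, hA0, hA⟩
    refine ⟨‖c‖ * A, by positivity, fun ξ => ?_⟩
    rw [Pi.smul_apply, Pi.smul_apply, ← smul_sub, norm_smul, mul_assoc]
    exact mul_le_mul_of_nonneg_left (hA ξ) (norm_nonneg c)

/-- An exponential sum involves only frequencies in some ball. -/
lemma exists_closedBall_of_mem_trigSpan {X : Set Plane} {f : Plane → ℂ} (hf : f ∈ trigSpan X) :
    ∃ R, 0 ≤ R ∧ f ∈ trigSpan (Metric.closedBall 0 R) := by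
  refine trigSpan_induction
    (p := fun f : Plane → ℂ => ∃ R, 0 ≤ R ∧ f ∈ trigSpan (Metric.closedBall 0 R))
    (fun x _ => ⟨‖x‖, norm_nonneg x, planeWave_mem_trigSpan (by simp)⟩)
    ⟨0, le_rfl, zero_mem _⟩ ?_ ?_ hf
  · rintro f g ⟨A, hA0, hA⟩ ⟨B, hB0, hB⟩
    exact ⟨max A B, le_max_of_le_left hA0, add_mem
      (trigSpan_mono (Metric.closedBall_subset_closedBall (le_max_left _ _)) hA)
      (trigSpan_mono (Metric.closedBall_subset_closedBall (le_max_right _ _)) hB)⟩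
  · rintro c f ⟨A, hA0, hA⟩
    exact ⟨A, hA0, Submodule.smul_mem _ c hA⟩

/-- Trigonometric polynomials of period `ℤ²`. -/
abbrev latticeSpan : Submodule ℂ (Plane → ℂ) := trigSpan (Set.range latticeVec)

lemma latticeSpan_periodic {f : Plane → ℂ} (hf : f ∈ latticeSpan) (ξ : Plane) (n : Fin 2 → ℤ) :
    f (ξ + latticeVec n) = f ξ := by
  refine trigSpan_induction (p := fun f : Plane → ℂ => f (ξ + latticeVec n) = f ξ)
    ?_ rfl ?_ ?_ hf
  · rintro _ ⟨k, rfl⟩; rw [planeWave_add_right, planeWave_lattice, mul_one]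
  · intro f g hf hg; simp [hf, hg]
  · intro c f hf; simp [hf]

lemma latticeSpan_mul {f g : Plane → ℂ} (hf : f ∈ latticeSpan) (hg : g ∈ latticeSpan) :
    f * g ∈ latticeSpan := by
  refine trigSpan_mul ?_ hf hg
  rintro _ ⟨m, rfl⟩ _ ⟨n, rfl⟩
  exact ⟨m + n, latticeVec_add m n⟩

lemma latticeSpan_conj {f : Plane → ℂ} (hf : f ∈ latticeSpan) :
    (fun ξ => conj (f ξ)) ∈ latticeSpan := by
  refine trigSpan_mono ?_ (trigSpan_conj hf)
  rintro x ⟨n, hn⟩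
  exact ⟨-n, by rw [latticeVec_neg, hn, neg_neg]⟩

lemma latticeSpan_comp_natCast_smul (a : ℕ) {f : Plane → ℂ} (hf : f ∈ latticeSpan) :
    (fun ξ => f ((a : ℝ) • ξ)) ∈ latticeSpan := by
  refine trigSpan_comp_smul ?_ hf
  rintro _ ⟨n, rfl⟩
  exact ⟨_, (natCast_smul_latticeVec a n).symm⟩

lemma planeWave_lattice_mem (n : Fin 2 → ℤ) : planeWave (latticeVec n) ∈ latticeSpan :=
  planeWave_mem_trigSpan ⟨n, rfl⟩

lemma IsTrigPolynomial.comp_two_pi_smul_mem {m : Plane → ℂ} (hm : IsTrigPolynomial m) :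
    (fun ξ : Plane => m ((2 * Real.pi) • ξ)) ∈ latticeSpan := by
  obtain ⟨c, hc⟩ := hm
  have : (fun ξ : Plane => m ((2 * Real.pi) • ξ))
      = ∑ k ∈ c.support, c k • planeWave (latticeVec k) := by
    funext ξ
    rw [hc, Finsupp.sum, Finset.sum_apply]
    refine Finset.sum_congr rfl fun k _ => ?_
    rw [Pi.smul_apply, smul_eq_mul, planeWave_eq_exp]
    congr 2
    simp [PiLp.inner_apply, latticeVec, Fin.sum_univ_two]
    ring
  rw [this]
  exact Submodule.sum_mem _ fun k _ => Submodule.smul_mem _ _ (planeWave_lattice_mem k)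

/-! ### Partial and infinite products of a mask. -/

/-- The partial product `∏_{1 ≤ j ≤ N} M(2⁻ʲ ξ)`. -/
noncomputable def partialMask (M : Plane → ℂ) (N : ℕ) (ξ : Plane) : ℂ :=
  ∏ j ∈ Finset.range N, M ((2 : ℝ)⁻¹ ^ (j + 1) • ξ)

/-- The infinite product `∏_{j ≥ 1} M(2⁻ʲ ξ)`. -/
noncomputable def infiniteMask (M : Plane → ℂ) (ξ : Plane) : ℂ :=
  ∏' j : ℕ, M ((2 : ℝ)⁻¹ ^ (j + 1) • ξ)

lemma norm_half_pow_smul (j : ℕ) (ξ : Plane) : ‖(2 : ℝ)⁻¹ ^ j • ξ‖ = (2 : ℝ)⁻¹ ^ j * ‖ξ‖ := by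
  rw [norm_smul, Real.norm_of_nonneg (by positivity)]

lemma summable_half_pow_succ : Summable fun j : ℕ => (2 : ℝ)⁻¹ ^ (j + 1) :=
  (summable_nat_add_iff 1).2 (summable_geometric_of_lt_one (by norm_num) (by norm_num))

section

variable {X : Set Plane} {M : Plane → ℂ}

lemma hasProdLocallyUniformlyOn_infiniteMask (hM : M ∈ trigSpan X) (h0 : M 0 = 1) (r : ℝ) :
    HasProdLocallyUniformlyOn (fun (j : ℕ) ξ => M ((2 : ℝ)⁻¹ ^ (j + 1) • ξ)) (infiniteMask M)
      (Metric.ball (0 : Plane) r) := by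
  obtain ⟨L, hL0, hL⟩ := lipschitz_at_zero_of_mem_trigSpan hM
  have hc := continuous_of_mem_trigSpan hM
  have := Summable.hasProdLocallyUniformlyOn_nat_one_add (K := Metric.ball (0 : Plane) r)
    (f := fun (j : ℕ) (ξ : Plane) => M ((2 : ℝ)⁻¹ ^ (j + 1) • ξ) - 1)
    (u := fun j => L * ((2 : ℝ)⁻¹ ^ (j + 1) * r)) Metric.isOpen_ball
    ((summable_half_pow_succ.mul_right r).mul_left L)
    (Filter.Eventually.of_forall fun j ξ hξ => by
      have := hL ((2 : ℝ)⁻¹ ^ (j + 1) • ξ)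
      rw [h0, norm_half_pow_smul] at this
      refine this.trans ?_
      have : ‖ξ‖ ≤ r := by simpa using (Metric.mem_ball.1 hξ).le
      gcongr)
    (fun j => by fun_prop)
  simpa only [add_sub_cancel] using! this

lemma tendsto_partialMask (hM : M ∈ trigSpan X) (h0 : M 0 = 1) (ξ : Plane) :
    Filter.Tendsto (fun N => partialMask M N ξ) Filter.atTop (𝓝 (infiniteMask M ξ)) := by
  have h := (hasProdLocallyUniformlyOn_infiniteMask hM h0 (‖ξ‖ + 1)).hasProd
    (x := ξ) (by simp)
  exact h.tendsto_prod_nat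

lemma continuous_infiniteMask (hM : M ∈ trigSpan X) (h0 : M 0 = 1) :
    Continuous (infiniteMask M) := by
  have hc := continuous_of_mem_trigSpan hM
  rw [continuous_iff_continuousAt]
  intro ξ
  have h := hasProdLocallyUniformlyOn_infiniteMask hM h0 (‖ξ‖ + 1)
  have hcont : ContinuousOn (infiniteMask M) (Metric.ball (0 : Plane) (‖ξ‖ + 1)) :=
    TendstoLocallyUniformlyOn.continuousOn h
      (Filter.Frequently.of_forall fun s => by fun_prop)
  exact hcont.continuousAt (Metric.isOpen_ball.mem_nhds (by simp))

lemma continuous_partialMask (hM : Continuous M) (N : ℕ) : Continuous (partialMask M N) := by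
  unfold partialMask; fun_prop

@[simp] lemma infiniteMask_zero (h0 : M 0 = 1) : infiniteMask M 0 = 1 := by
  simp [infiniteMask, h0]

lemma partialMask_add (M : Plane → ℂ) (N K : ℕ) (ξ : Plane) :
    partialMask M (N + K) ξ = partialMask M N ξ * partialMask M K ((2 : ℝ)⁻¹ ^ N • ξ) := by
  rw [partialMask, Finset.prod_range_add]
  congr 1
  refine Finset.prod_congr rfl fun j _ => ?_
  rw [smul_smul, ← pow_add]
  congr 3
  ring

lemma partialMask_succ' (M : Plane → ℂ) (N : ℕ) (ξ : Plane) :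
    partialMask M (N + 1) ξ = M ((2 : ℝ)⁻¹ • ξ) * partialMask M N ((2 : ℝ)⁻¹ • ξ) := by
  rw [add_comm N 1, partialMask_add]; simp [partialMask]

lemma infiniteMask_eq_partialMask_mul (hM : M ∈ trigSpan X) (h0 : M 0 = 1) (N : ℕ) (ξ : Plane) :
    infiniteMask M ξ = partialMask M N ξ * infiniteMask M ((2 : ℝ)⁻¹ ^ N • ξ) := by
  have h1 := (tendsto_partialMask hM h0 ξ).comp (Filter.tendsto_add_atTop_nat N)
  have h2 := (tendsto_partialMask hM h0 ((2 : ℝ)⁻¹ ^ N • ξ)).const_mul (partialMask M N ξ)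
  refine tendsto_nhds_unique h1 (h2.congr fun K => ?_)
  simp only [Function.comp_apply]
  rw [add_comm K N, partialMask_add]

/-- The partial products grow at most polynomially, uniformly in the number of factors. -/
lemma exists_norm_partialMask_le (hM : M ∈ trigSpan X) (h0 : M 0 = 1) :
    ∃ (C : ℝ) (k : ℕ), 0 < C ∧ ∀ N ξ, ‖partialMask M N ξ‖ ≤ C * (1 + ‖ξ‖) ^ k := by
  obtain ⟨L, hL0, hL⟩ := lipschitz_at_zero_of_mem_trigSpan hM
  obtain ⟨B, hB⟩ := bounded_of_mem_trigSpan hM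
  -- For |ξ| ≥ 1 one has (4/3)(1 + |ξ|/2) ≤ 1 + |ξ|. A factor of size at most B < (4/3)ᵏ is
  -- therefore absorbed when ξ is halved.
  obtain ⟨k, hk⟩ := pow_unbounded_of_one_lt B (show (1 : ℝ) < 4 / 3 by norm_num)
  -- In the unit ball the first factor is at most exp(L|ξ|/2), and so, inductively, is the product
  -- of the others at ξ/2.
  have hsmall : ∀ N (ξ : Plane), ‖ξ‖ ≤ 1 → ‖partialMask M N ξ‖ ≤ Real.exp (L * ‖ξ‖) := by
    intro N
    induction N with
    | zero => intro ξ _; simpa [partialMask] using by positivity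
    | succ N ih =>
      intro ξ hξ
      have hh : ‖(2 : ℝ)⁻¹ • ξ‖ = 2⁻¹ * ‖ξ‖ := by simpa using norm_half_pow_smul 1 ξ
      rw [partialMask_succ', norm_mul]
      have h1 : ‖M ((2 : ℝ)⁻¹ • ξ)‖ ≤ Real.exp (L * (2⁻¹ * ‖ξ‖)) := by
        have h := hL ((2 : ℝ)⁻¹ • ξ)
        rw [h0, hh] at h
        calc ‖M ((2 : ℝ)⁻¹ • ξ)‖ = ‖(M ((2 : ℝ)⁻¹ • ξ) - 1) + 1‖ := by rw [sub_add_cancel]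
          _ ≤ L * (2⁻¹ * ‖ξ‖) + 1 := (norm_add_le _ _).trans (by rw [norm_one]; gcongr)
          _ ≤ _ := Real.add_one_le_exp _
      have h2 := ih ((2 : ℝ)⁻¹ • ξ) (by rw [hh]; linarith [norm_nonneg ξ])
      rw [hh] at h2
      calc _ ≤ Real.exp (L * (2⁻¹ * ‖ξ‖)) * Real.exp (L * (2⁻¹ * ‖ξ‖)) := by gcongr
        _ = Real.exp (L * ‖ξ‖) := by rw [← Real.exp_add]; congr 1; ring
  refine ⟨Real.exp L, k, Real.exp_pos L, fun N => ?_⟩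
  induction N with
  | zero =>
    intro ξ
    have h1 : (1 : ℝ) ≤ Real.exp L := Real.one_le_exp hL0
    have h2 : (1 : ℝ) ≤ (1 + ‖ξ‖) ^ k := one_le_pow₀ (by linarith [norm_nonneg ξ])
    simpa [partialMask] using one_le_mul_of_one_le_of_one_le h1 h2
  | succ N ih =>
    intro ξ
    have h2 : (1 : ℝ) ≤ (1 + ‖ξ‖) ^ k := one_le_pow₀ (by linarith [norm_nonneg ξ])
    rcases le_total ‖ξ‖ 1 with hξ | hξ
    · refine (hsmall _ ξ hξ).trans ?_
      calc Real.exp (L * ‖ξ‖) ≤ Real.exp L := by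
            apply Real.exp_le_exp.2; exact mul_le_of_le_one_right hL0 hξ
        _ ≤ _ := le_mul_of_one_le_right (Real.exp_pos L).le h2
    · have hh : ‖(2 : ℝ)⁻¹ • ξ‖ = 2⁻¹ * ‖ξ‖ := by simpa using norm_half_pow_smul 1 ξ
      rw [partialMask_succ', norm_mul]
      have h3 := ih ((2 : ℝ)⁻¹ • ξ)
      rw [hh] at h3
      have h4 : (4 / 3 : ℝ) ^ k * (1 + 2⁻¹ * ‖ξ‖) ^ k ≤ (1 + ‖ξ‖) ^ k := by
        rw [← mul_pow]
        gcongr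
        linarith
      calc _ ≤ (4 / 3 : ℝ) ^ k * (Real.exp L * (1 + 2⁻¹ * ‖ξ‖) ^ k) := by
            gcongr
            exact (hB _).trans hk.le
        _ = Real.exp L * ((4 / 3 : ℝ) ^ k * (1 + 2⁻¹ * ‖ξ‖) ^ k) := by ring
        _ ≤ _ := by gcongr

lemma norm_infiniteMask_le (hM : M ∈ trigSpan X) (h0 : M 0 = 1) {C : ℝ} {k : ℕ}
    (h : ∀ N ξ, ‖partialMask M N ξ‖ ≤ C * (1 + ‖ξ‖) ^ k) (ξ : Plane) :
    ‖infiniteMask M ξ‖ ≤ C * (1 + ‖ξ‖) ^ k :=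
  le_of_tendsto (tendsto_partialMask hM h0 ξ).norm (Filter.Eventually.of_forall fun N => h N ξ)

/-- All partial products have their frequencies in one ball. -/
lemma partialMask_mem_trigSpan {R : ℝ} (hM : M ∈ trigSpan (Metric.closedBall 0 R)) (N : ℕ) :
    partialMask M N ∈ trigSpan (Metric.closedBall 0 ((1 - (2 : ℝ)⁻¹ ^ N) * R)) := by
  induction N with
  | zero =>
    have : partialMask M 0 = planeWave 0 := by funext ξ; simp [partialMask]
    rw [this]
    exact planeWave_mem_trigSpan (by simp)
  | succ N ih =>
    have : partialMask M (N + 1)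
        = partialMask M N * fun ξ => M ((2 : ℝ)⁻¹ ^ (N + 1) • ξ) := by
      funext ξ; simp [partialMask, Finset.prod_range_succ]
    rw [this]
    -- The new factor has frequencies of size at most 2⁻⁽ᴺ⁺¹⁾R, the next term of a geometric series
    -- with sum R.
    refine trigSpan_mul (Y := Metric.closedBall 0 ((2 : ℝ)⁻¹ ^ (N + 1) * R)) ?_ ih
      (trigSpan_comp_smul ?_ hM)
    · intro x hx y hy
      rw [mem_closedBall_zero_iff] at *
      refine (norm_add_le _ _).trans ((add_le_add hx hy).trans (le_of_eq ?_))
      ring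
    · intro x hx
      rw [mem_closedBall_zero_iff] at *
      rw [norm_half_pow_smul]
      gcongr

end

/-! ### Reproduction of the infinite product by Schwartz convolution. -/

lemma SchwartzMap.exists_one_add_norm_pow_mul_le (η : SchwartzMap Plane ℂ) (k : ℕ) :
    ∃ C, 0 ≤ C ∧ ∀ u, (1 + ‖u‖) ^ k * ‖η u‖ ≤ C := by
  have h := fun u => SchwartzMap.one_add_le_sup_seminorm_apply (𝕜 := ℝ) (m := (k, 0)) (k := k)
    (n := 0) le_rfl le_rfl η u
  simp only [norm_iteratedFDeriv_zero] at h
  exact ⟨_, (by positivity : (0 : ℝ) ≤ (1 + ‖(0 : Plane)‖) ^ k * ‖η 0‖).trans (h 0), h⟩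

lemma integrable_one_add_norm_pow_neg_four :
    Integrable fun u : Plane => ((1 + ‖u‖) ^ 4)⁻¹ := by
  have h := integrable_one_add_norm (E := Plane) (μ := volume) (r := 4) (by simp; norm_num)
  refine h.congr (Filter.Eventually.of_forall fun u => ?_)
  simp only
  rw [Real.rpow_neg (by positivity)]
  norm_cast

lemma SchwartzMap.integrable_one_add_norm_pow_mul (η : SchwartzMap Plane ℂ) (k : ℕ) :
    Integrable fun u => (1 + ‖u‖) ^ k * ‖η u‖ := by
  obtain ⟨C, hC0, hC⟩ := η.exists_one_add_norm_pow_mul_le (k + 4)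
  refine (integrable_one_add_norm_pow_neg_four.const_mul C).mono'
    (by have := η.continuous; exact Continuous.aestronglyMeasurable (by fun_prop))
    (Filter.Eventually.of_forall fun u => ?_)
  rw [Real.norm_of_nonneg (by positivity), ← div_eq_mul_inv, le_div_iff₀ (by positivity)]
  refine le_trans (le_of_eq ?_) (hC u)
  ring

open scoped ContDiff in
lemma exists_schwartzMap_eq_one_on_closedBall (R : ℝ) :
    ∃ β : SchwartzMap Plane ℂ, ∀ x ∈ Metric.closedBall (0 : Plane) R, β x = 1 := by
  obtain ⟨b, hbR⟩ : ∃ b : ContDiffBump (0 : Plane), R ≤ b.rIn :=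
    ⟨⟨|R| + 1, |R| + 2, by positivity, by linarith⟩, (le_abs_self R).trans (by simp)⟩
  have hb : ContDiff ℝ ∞ fun u => (b u : ℂ) := Complex.ofRealCLM.contDiff.comp b.contDiff
  have hbc : HasCompactSupport fun u => (b u : ℂ) :=
    b.hasCompactSupport.comp_left (g := Complex.ofReal) rfl
  refine ⟨hbc.toSchwartzMap hb, fun x hx => ?_⟩
  have : b x = 1 := b.one_of_mem_closedBall (Metric.closedBall_subset_closedBall hbR hx)
  rw [HasCompactSupport.toSchwartzMap_toFun, this, Complex.ofReal_one]

/-- Fourier inversion: convolution with 𝓕β multiplies the exponential of frequency x by β(x), so β =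
1 on a ball reproduces the frequencies there. -/
lemma integral_planeWave_sub_mul_fourier (β : SchwartzMap Plane ℂ) (x ξ : Plane) :
    ∫ u, planeWave x (ξ - u) * (𝓕 β) u = planeWave x ξ * β x := by
  have h1 : ∀ u, planeWave x (ξ - u) * (𝓕 β) u
      = planeWave x ξ * ((Real.fourierChar (inner ℝ u x)) • (𝓕 β) u) := by
    intro u
    rw [sub_eq_add_neg, planeWave_add_right, mul_assoc, Circle.smul_def, smul_eq_mul]
    congr 2
    simp [planeWave, inner_neg_right, real_inner_comm]
  simp_rw [h1]
  rw [integral_const_mul, ← Real.fourierInv_eq, ← SchwartzMap.fourierInv_coe,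
    FourierTransform.fourierInv_fourier_eq]

/-- A Schwartz function which reproduces, by convolution, all exponential sums with frequencies
in a given ball. -/
lemma exists_reproducing_schwartzMap (R : ℝ) :
    ∃ η : SchwartzMap Plane ℂ, ∀ f ∈ trigSpan (Metric.closedBall 0 R), ∀ ξ,
      ∫ u, f (ξ - u) * η u = f ξ := by
  obtain ⟨β, hβ⟩ := exists_schwartzMap_eq_one_on_closedBall R
  have hint : ∀ f ∈ trigSpan (Metric.closedBall (0 : Plane) R), ∀ ξ,
      Integrable fun u => f (ξ - u) * (𝓕 β) u := by
    intro f hf ξ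
    obtain ⟨B, hB⟩ := bounded_of_mem_trigSpan hf
    have hc := continuous_of_mem_trigSpan hf
    exact ((𝓕 β).integrable).bdd_mul (Continuous.aestronglyMeasurable (by fun_prop))
      (Filter.Eventually.of_forall fun u => hB _)
  refine ⟨𝓕 β, fun f hf ξ => ?_⟩
  -- Membership is carried through the induction because additivity of the integral needs
  -- integrability, which `hint` derives from it.
  suffices f ∈ trigSpan (Metric.closedBall (0 : Plane) R) ∧
    ∫ u, f (ξ - u) * (𝓕 β) u = f ξ from this.2
  refine trigSpan_induction (X := Metric.closedBall (0 : Plane) R)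
    (p := fun f : Plane → ℂ => f ∈ trigSpan (Metric.closedBall (0 : Plane) R) ∧
      ∫ u, f (ξ - u) * (𝓕 β) u = f ξ) (fun x hx => ⟨planeWave_mem_trigSpan hx, ?_⟩) ?_ ?_ ?_ hf
  · rw [integral_planeWave_sub_mul_fourier, hβ x hx, mul_one]
  · exact ⟨zero_mem _, by simp⟩
  · rintro f g ⟨hf, hf'⟩ ⟨hg, hg'⟩
    refine ⟨add_mem hf hg, ?_⟩
    simp only [Pi.add_apply, add_mul]
    rw [integral_add (hint f hf ξ) (hint g hg ξ), hf', hg']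
  · rintro c f ⟨hf, hf'⟩
    refine ⟨Submodule.smul_mem _ c hf, ?_⟩
    simp only [Pi.smul_apply, smul_eq_mul, mul_assoc]
    rw [integral_const_mul, hf']

/-- One η serves all partial products, as their frequencies share a ball. The polynomial bound
uniform in N, against the decay of η, lets the identity pass to the limit. This plays the role of
the compact support of φ. -/
lemma exists_reproducing_infiniteMask {X : Set Plane} {M : Plane → ℂ} (hM : M ∈ trigSpan X)
    (h0 : M 0 = 1) :
    ∃ η : SchwartzMap Plane ℂ, ∀ ξ, ∫ u, infiniteMask M (ξ - u) * η u = infiniteMask M ξ := by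
  obtain ⟨R, hR0, hR⟩ := exists_closedBall_of_mem_trigSpan hM
  obtain ⟨C, k, hC0, hC⟩ := exists_norm_partialMask_le hM h0
  obtain ⟨η, hη⟩ := exists_reproducing_schwartzMap R
  refine ⟨η, fun ξ => ?_⟩
  have hmem : ∀ N, partialMask M N ∈ trigSpan (Metric.closedBall 0 R) := fun N =>
    trigSpan_mono (Metric.closedBall_subset_closedBall
      (mul_le_of_le_one_left hR0 (by linarith [show (0 : ℝ) ≤ 2⁻¹ ^ N by positivity])))
      (partialMask_mem_trigSpan hR N)
  have hlim : Filter.Tendsto (fun N => ∫ u, partialMask M N (ξ - u) * η u) Filter.atTop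
      (𝓝 (∫ u, infiniteMask M (ξ - u) * η u)) := by
    refine tendsto_integral_of_dominated_convergence
      (fun u => C * (1 + ‖ξ‖) ^ k * ((1 + ‖u‖) ^ k * ‖η u‖)) (fun N => ?_)
      ((η.integrable_one_add_norm_pow_mul k).const_mul _)
      (fun N => Filter.Eventually.of_forall fun u => ?_)
      (Filter.Eventually.of_forall fun u => (tendsto_partialMask hM h0 _).mul_const _)
    · have := continuous_of_mem_trigSpan (hmem N)
      have := η.continuous
      exact Continuous.aestronglyMeasurable (by fun_prop)
    · rw [norm_mul]
      have h1 : 1 + ‖ξ - u‖ ≤ (1 + ‖ξ‖) * (1 + ‖u‖) := by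
        nlinarith [norm_sub_le ξ u, norm_nonneg ξ, norm_nonneg u,
          mul_nonneg (norm_nonneg ξ) (norm_nonneg u)]
      calc _ ≤ C * (1 + ‖ξ - u‖) ^ k * ‖η u‖ := by gcongr; exact hC _ _
        _ ≤ C * ((1 + ‖ξ‖) * (1 + ‖u‖)) ^ k * ‖η u‖ := by gcongr
        _ = _ := by rw [mul_pow]; ring
  refine tendsto_nhds_unique hlim ?_
  simp_rw [fun N => hη _ (hmem N) ξ]
  exact tendsto_partialMask hM h0 ξ

/-! ### Weighted bounds and square summability over lattice cosets. -/

/-- The decaying weight `(1 + |u|)⁻⁴`. -/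
noncomputable def decayWeight (u : Plane) : ℝ≥0∞ := ENNReal.ofReal ((1 + ‖u‖) ^ 4)⁻¹

@[fun_prop] lemma measurable_decayWeight : Measurable decayWeight := by
  unfold decayWeight; fun_prop

lemma decayWeight_add_le (a b : Plane) :
    decayWeight (a + b) ≤ ENNReal.ofReal ((1 + ‖a‖) ^ 4) * decayWeight b := by
  rw [decayWeight, decayWeight, ← ENNReal.ofReal_mul (by positivity)]
  apply ENNReal.ofReal_le_ofReal
  have h : 1 + ‖b‖ ≤ (1 + ‖a + b‖) * (1 + ‖a‖) := by
    have : ‖b‖ ≤ ‖a + b‖ + ‖a‖ := by simpa using norm_sub_le (a + b) a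
    nlinarith [mul_nonneg (norm_nonneg (a + b)) (norm_nonneg a)]
  rw [← div_eq_mul_inv, inv_eq_one_div, div_le_div_iff₀ (by positivity) (by positivity), one_mul,
    ← mul_pow, mul_comm (1 + ‖a‖)]
  gcongr

lemma lintegral_decayWeight_lt_top : ∫⁻ u, decayWeight u < ∞ := by
  have h := integrable_one_add_norm_pow_neg_four.hasFiniteIntegral
  rwa [hasFiniteIntegral_iff_ofReal (Filter.Eventually.of_forall fun u => by positivity)] at h

lemma norm_le_norm_latticeVec (n : Fin 2 → ℤ) : ‖n‖ ≤ ‖latticeVec n‖ := by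
  refine (pi_norm_le_iff_of_nonneg (norm_nonneg _)).2 fun i => ?_
  have := PiLp.norm_apply_le (p := 2) (latticeVec n) i
  simpa [latticeVec, Int.norm_eq_abs] using this

lemma tsum_decayWeight_latticeVec_lt_top : ∑' n, decayWeight (latticeVec n) < ∞ := by
  have hs : Summable fun n : Fin 2 → ℤ => ((1 + ‖latticeVec n‖) ^ 4)⁻¹ := by
    refine Summable.of_norm_bounded_eventually
      (EisensteinSeries.summable_one_div_norm_rpow (k := 4) (by norm_num)) ?_
    -- The origin is excluded because the comparison term ‖0‖⁻⁴ takes the default value 0 there.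
    filter_upwards [(Set.finite_singleton (0 : Fin 2 → ℤ)).compl_mem_cofinite] with n hn
    have hn0 : 0 < ‖n‖ := norm_pos_iff.2 hn
    rw [Real.norm_of_nonneg (by positivity), Real.rpow_neg hn0.le]
    norm_cast
    have := norm_le_norm_latticeVec n
    gcongr
    linarith
  exact lt_top_iff_ne_top.2 hs.tsum_ofReal_ne_top

lemma exists_latticeVec_sub_norm_le (u : Plane) : ∃ n, ‖latticeVec n - u‖ ≤ 2 := by
  refine ⟨fun i => round (u i), ?_⟩
  have h : ∀ i, ‖(latticeVec (fun i => round (u i)) - u) i‖ ^ 2 ≤ 1 := by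
    intro i
    have := abs_sub_round (u i)
    rw [abs_sub_comm] at this
    have h2 : ‖(latticeVec (fun i => round (u i)) - u) i‖ ≤ 1 / 2 := by
      simpa [latticeVec] using this
    nlinarith [norm_nonneg ((latticeVec (fun i => round (u i)) - u) i)]
  rw [EuclideanSpace.norm_eq, Fin.sum_univ_two, Real.sqrt_le_left (by norm_num)]
  linarith [h 0, h 1]

/-- Recentring at a lattice point within distance 2 of u costs a factor (1 + 2)⁴, independent of u.
-/
lemma exists_tsum_decayWeight_le :
    ∃ S, S < ∞ ∧ ∀ u, ∑' n, decayWeight (latticeVec n - u) ≤ S := by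
  refine ⟨ENNReal.ofReal (3 ^ 4) * ∑' n, decayWeight (latticeVec n),
    ENNReal.mul_lt_top ENNReal.ofReal_lt_top tsum_decayWeight_latticeVec_lt_top, fun u => ?_⟩
  obtain ⟨m, hm⟩ := exists_latticeVec_sub_norm_le u
  rw [← (Equiv.subRight m).tsum_eq fun n => decayWeight (latticeVec n), ← ENNReal.tsum_mul_left]
  refine ENNReal.tsum_le_tsum fun n => ?_
  have e : latticeVec n - u = (latticeVec m - u) + latticeVec (n - m) := by
    rw [latticeVec_sub]; abel
  rw [e]
  refine (decayWeight_add_le _ _).trans ?_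
  rw [Equiv.subRight_apply]
  gcongr
  linarith

/-- Cauchy–Schwarz in H = H ∗ η, using |η(u)| ≤ C(1 + |u|)⁻⁴. -/
lemma enorm_sq_le_of_reproducing {H : Plane → ℂ} (hH : Continuous H) {η : SchwartzMap Plane ℂ}
    (h : ∀ ξ, ∫ u, H (ξ - u) * η u = H ξ) :
    ∃ A, A < ∞ ∧ ∀ ξ, ‖H ξ‖ₑ ^ 2 ≤ A * ∫⁻ u, ‖H u‖ₑ ^ 2 * decayWeight (ξ - u) := by
  obtain ⟨C, hC0, hC⟩ := η.exists_one_add_norm_pow_mul_le 4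
  refine ⟨ENNReal.ofReal C ^ 2 * ∫⁻ u, decayWeight u, ENNReal.mul_lt_top
    (ENNReal.pow_lt_top ENNReal.ofReal_lt_top) lintegral_decayWeight_lt_top, fun ξ => ?_⟩
  -- v is the square root of the weight: one copy stays with H, the other is square integrable.
  let v : Plane → ℝ≥0∞ := fun u => ENNReal.ofReal ((1 + ‖u‖) ^ 2)⁻¹
  have hv : Measurable v := by simp only [v]; fun_prop
  have hv2 : ∀ u, v u ^ 2 = decayWeight u := fun u => by
    simp only [v, decayWeight]
    rw [← ENNReal.ofReal_pow (by positivity), ← inv_pow, ← inv_pow, ← pow_mul]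
  have h1 : ‖H ξ‖ₑ ≤ ENNReal.ofReal C * ∫⁻ u, ((fun u => ‖H (ξ - u)‖ₑ * v u) * v) u := by
    rw [← h ξ, ← lintegral_const_mul' _ _ ENNReal.ofReal_ne_top]
    refine (enorm_integral_le_lintegral_enorm _).trans (lintegral_mono fun u => ?_)
    simp only [Pi.mul_apply]
    rw [enorm_mul, mul_assoc, ← sq, hv2, mul_left_comm]
    gcongr
    rw [decayWeight, ← ENNReal.ofReal_mul hC0, ← ofReal_norm]
    apply ENNReal.ofReal_le_ofReal
    rw [← div_eq_mul_inv, le_div_iff₀ (by positivity), mul_comm]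
    exact hC u
  have h2 := ENNReal.lintegral_mul_le_Lp_mul_Lq (volume : Measure Plane)
    Real.HolderConjugate.two_two (f := fun u => ‖H (ξ - u)‖ₑ * v u) (g := v)
    (by fun_prop) (by fun_prop)
  have h3 : (∫⁻ u, ((fun u => ‖H (ξ - u)‖ₑ * v u) * v) u) ^ 2
      ≤ (∫⁻ u, (‖H (ξ - u)‖ₑ * v u) ^ 2) * ∫⁻ u, decayWeight u := by
    refine (pow_le_pow_left' h2 2).trans (le_of_eq ?_)
    simp only [ENNReal.rpow_two, hv2]
    rw [mul_pow, ← ENNReal.rpow_natCast, ← ENNReal.rpow_natCast, ← ENNReal.rpow_mul,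
      ← ENNReal.rpow_mul]
    norm_num
  have h4 : ∫⁻ u, (‖H (ξ - u)‖ₑ * v u) ^ 2 = ∫⁻ u, ‖H u‖ₑ ^ 2 * decayWeight (ξ - u) := by
    simp only [mul_pow, hv2]
    rw [← lintegral_sub_left_eq_self (fun u => ‖H u‖ₑ ^ 2 * decayWeight (ξ - u)) ξ]
    simp
  calc ‖H ξ‖ₑ ^ 2
      ≤ (ENNReal.ofReal C * ∫⁻ u, ((fun u => ‖H (ξ - u)‖ₑ * v u) * v) u) ^ 2 :=
        pow_le_pow_left' h1 2
    _ ≤ ENNReal.ofReal C ^ 2 *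
        ((∫⁻ u, (‖H (ξ - u)‖ₑ * v u) ^ 2) * ∫⁻ u, decayWeight u) := by
        rw [mul_pow]; gcongr
    _ = _ := by rw [h4]; ring

/-- A square integrable function reproduced by convolution with a Schwartz function has square
summable lattice translates, locally uniformly. -/
lemma exists_summable_bound_of_reproducing {H : Plane → ℂ} (hH : Continuous H)
    (hL2 : MemLp H 2) {η : SchwartzMap Plane ℂ} (h : ∀ ξ, ∫ u, H (ξ - u) * η u = H ξ) (r : ℝ) :
    ∃ b : (Fin 2 → ℤ) → ℝ, Summable b ∧
      ∀ n, ∀ ξ ∈ Metric.ball (0 : Plane) r, ‖H (ξ + latticeVec n)‖ ^ 2 ≤ b n := by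
  obtain ⟨A, hA, hA'⟩ := enorm_sq_le_of_reproducing hH h
  obtain ⟨S, hS, hS'⟩ := exists_tsum_decayWeight_le
  -- Moving the weight from ξ + n to n costs at most (1 + r)⁴, which frees the bound of ξ. Summing
  -- over n under the integral leaves a multiple of ∫ |H|².
  let c : (Fin 2 → ℤ) → ℝ≥0∞ := fun n =>
    A * ENNReal.ofReal ((1 + r) ^ 4) * ∫⁻ u, ‖H u‖ₑ ^ 2 * decayWeight (latticeVec n - u)
  have hfin : ∫⁻ u, ‖H u‖ₑ ^ 2 < ∞ := by
    have := lintegral_rpow_enorm_lt_top_of_eLpNorm_lt_top (by norm_num) (by norm_num) hL2.2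
    simpa using this
  have hc : ∑' n, c n ≠ ∞ := by
    simp only [c]
    rw [ENNReal.tsum_mul_left, ← lintegral_tsum (fun n => by fun_prop)]
    simp_rw [ENNReal.tsum_mul_left]
    refine (ENNReal.mul_lt_top (ENNReal.mul_lt_top hA ENNReal.ofReal_lt_top) ?_).ne
    calc ∫⁻ u, ‖H u‖ₑ ^ 2 * ∑' n, decayWeight (latticeVec n - u)
        ≤ ∫⁻ u, ‖H u‖ₑ ^ 2 * S := lintegral_mono fun u => by gcongr; exact hS' u
      _ = (∫⁻ u, ‖H u‖ₑ ^ 2) * S := lintegral_mul_const' _ _ hS.ne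
      _ < ∞ := ENNReal.mul_lt_top hfin hS
  refine ⟨fun n => (c n).toReal, ENNReal.summable_toReal hc, fun n ξ hξ => ?_⟩
  have hcn : c n ≠ ∞ := ENNReal.ne_top_of_tsum_ne_top hc n
  rw [← toReal_enorm, ← ENNReal.toReal_pow]
  refine ENNReal.toReal_mono hcn ((hA' _).trans ?_)
  simp only [c]
  rw [mul_assoc]
  gcongr
  rw [← lintegral_const_mul' _ _ ENNReal.ofReal_ne_top]
  refine lintegral_mono fun u => ?_
  simp only
  rw [add_sub_assoc, mul_left_comm]
  gcongr
  refine (decayWeight_add_le _ _).trans ?_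
  have : ‖ξ‖ ≤ r := by simpa using (Metric.mem_ball.1 hξ).le
  gcongr

/-! ### Plancherel for translates in L². -/

lemma SchwartzMap.fourier_compSubConst (f : SchwartzMap Plane ℂ) (a ξ : Plane) :
    (𝓕 (f.compSubConstCLM ℂ a)) ξ = planeWave a ξ * (𝓕 f) ξ := by
  rw [SchwartzMap.fourier_coe, SchwartzMap.fourier_coe, Real.fourier_eq, Real.fourier_eq,
    ← integral_const_mul, ← integral_add_right_eq_self _ a]
  refine integral_congr_ae (Filter.Eventually.of_forall fun x => ?_)
  simp only [SchwartzMap.compSubConstCLM_apply, add_sub_cancel_right, inner_add_left, neg_add_rev,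
    AddChar.map_add_eq_mul, planeWave, Circle.smul_def, Circle.coe_mul, smul_eq_mul, mul_assoc]

/-- Translation by `a` on `L²`. -/
noncomputable def translateLp (a : Plane) :
    Lp ℂ 2 (volume : Measure Plane) →L[ℂ] Lp ℂ 2 (volume : Measure Plane) :=
  (Lp.compMeasurePreservingₗᵢ ℂ (fun x : Plane => x - a)
    (measurePreserving_sub_right volume a)).toContinuousLinearMap

lemma coeFn_translateLp (a : Plane) (φ : Lp ℂ 2 (volume : Measure Plane)) :
    translateLp a φ =ᵐ[volume] fun x => φ (x - a) :=
  Lp.coeFn_compMeasurePreserving φ (measurePreserving_sub_right volume a)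

lemma memLp_top_planeWave (a : Plane) : MemLp (planeWave a) ∞ (volume : Measure Plane) :=
  memLp_top_of_bound (continuous_planeWave a).aestronglyMeasurable 1
    (Filter.Eventually.of_forall fun ξ => (norm_planeWave a ξ).le)

/-- Multiplication by an exponential on `L²`. -/
noncomputable def modulateLp (a : Plane) :
    Lp ℂ 2 (volume : Measure Plane) →L[ℂ] Lp ℂ 2 (volume : Measure Plane) :=
  (ContinuousLinearMap.mul ℂ ℂ).holderL volume ∞ 2 2 ((memLp_top_planeWave a).toLp _)

lemma coeFn_modulateLp (a : Plane) (φ : Lp ℂ 2 (volume : Measure Plane)) :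
    modulateLp a φ =ᵐ[volume] fun ξ => planeWave a ξ * φ ξ := by
  filter_upwards [(ContinuousLinearMap.mul ℂ ℂ).coeFn_holder (r := 2)
    ((memLp_top_planeWave a).toLp _) φ, (memLp_top_planeWave a).coeFn_toLp] with ξ h1 h2
  rw [h2] at h1
  exact h1

lemma fourier_translateLp (a : Plane) (φ : Lp ℂ 2 (volume : Measure Plane)) :
    𝓕 (translateLp a φ) = modulateLp a (𝓕 φ) := by
  refine DenseRange.induction_on
    (p := fun φ : Lp ℂ 2 (volume : Measure Plane) => 𝓕 (translateLp a φ) = modulateLp a (𝓕 φ))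
    (SchwartzMap.denseRange_toLpCLM (p := 2) (E := Plane) (F := ℂ) (μ := volume)
      ENNReal.ofNat_ne_top) φ ?_ ?_
  · exact isClosed_eq
      ((Lp.fourierTransformₗᵢ Plane ℂ).continuous.comp (translateLp a).continuous)
      ((modulateLp a).continuous.comp (Lp.fourierTransformₗᵢ Plane ℂ).continuous)
  · intro f
    rw [SchwartzMap.toLpCLM_apply]
    have h1 : translateLp a (f.toLp 2) = (f.compSubConstCLM ℂ a).toLp 2 := by
      apply Lp.ext
      filter_upwards [coeFn_translateLp a (f.toLp 2), (f.compSubConstCLM ℂ a).coeFn_toLp 2 volume,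
        (measurePreserving_sub_right volume a).quasiMeasurePreserving.ae
          (f.coeFn_toLp 2 volume)] with x h1 h2 h3
      rw [h1, h2, h3, SchwartzMap.compSubConstCLM_apply]
    rw [h1, SchwartzMap.toLp_fourier_eq, SchwartzMap.toLp_fourier_eq]
    apply Lp.ext
    filter_upwards [(𝓕 (f.compSubConstCLM ℂ a)).coeFn_toLp 2 volume,
      coeFn_modulateLp a ((𝓕 f).toLp 2), (𝓕 f).coeFn_toLp 2 volume] with ξ h1 h2 h3
    rw [h1, h2, h3, SchwartzMap.fourier_compSubConst]

/-- Plancherel's identity for translates. -/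
lemma integral_translate_mul_conj_translate (φ φ' : Lp ℂ 2 (volume : Measure Plane))
    (a b : Plane) :
    ∫ x, φ (x - a) * conj (φ' (x - b))
      = ∫ ξ, (𝓕 φ : Lp ℂ 2 (volume : Measure Plane)) ξ
        * conj ((𝓕 φ' : Lp ℂ 2 (volume : Measure Plane)) ξ) * planeWave (a - b) ξ := by
  have h := Lp.inner_fourier_eq (translateLp b φ') (translateLp a φ)
  rw [fourier_translateLp, fourier_translateLp, L2.inner_def, L2.inner_def] at h
  symm
  convert h using 1
  · refine integral_congr_ae ?_
    filter_upwards [coeFn_modulateLp a (𝓕 φ), coeFn_modulateLp b (𝓕 φ')] with ξ h1 h2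
    rw [h1, h2, sub_eq_add_neg, planeWave_add_left, planeWave_neg_left, RCLike.inner_apply,
      map_mul]
    ring
  · refine integral_congr_ae ?_
    filter_upwards [coeFn_translateLp a φ, coeFn_translateLp b φ'] with x h1 h2
    rw [h1, h2, RCLike.inner_apply]

/-! ### Periodization over the unit square and Fourier coefficients. -/

/-- The half-open unit square centred at the origin. -/
def unitBox : Set Plane := {ξ | ∀ i, ξ i ∈ Set.Ioc (-(1 / 2) : ℝ) (-(1 / 2) + 1)}

lemma unitBox_eq_preimage : unitBox = WithLp.ofLp ⁻¹'
    Set.univ.pi fun _ : Fin 2 => Set.Ioc (-(1 / 2) : ℝ) (-(1 / 2) + 1) := by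
  ext ξ; simp [unitBox]

lemma measurableSet_unitBox : MeasurableSet unitBox := by
  rw [unitBox_eq_preimage]
  exact (WithLp.measurable_ofLp 2 _) (MeasurableSet.univ_pi fun _ => measurableSet_Ioc)

lemma volume_unitBox : volume unitBox = 1 := by
  rw [unitBox_eq_preimage, (PiLp.volume_preserving_ofLp (Fin 2)).measure_preimage
    (MeasurableSet.univ_pi fun _ => measurableSet_Ioc).nullMeasurableSet, Real.volume_pi_Ioc]
  simp

lemma unitBox_subset_ball : unitBox ⊆ Metric.ball (0 : Plane) 2 := by
  intro ξ hξ
  rw [mem_ball_zero_iff, EuclideanSpace.norm_eq, Fin.sum_univ_two, Real.sqrt_lt' (by norm_num),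
    Real.norm_eq_abs, Real.norm_eq_abs, sq_abs, sq_abs]
  have h0 := hξ 0
  have h1 := hξ 1
  rw [Set.mem_Ioc] at h0 h1
  nlinarith

lemma existsUnique_sub_latticeVec_mem_unitBox (ξ : Plane) :
    ∃! n, ξ - latticeVec n ∈ unitBox := by
  have h := fun i => existsUnique_sub_zsmul_mem_Ioc (one_pos (α := ℝ)) (ξ i) (-(1 / 2))
  choose n hn hu using h
  refine ⟨n, fun i => ?_, fun m hm => funext fun i => hu i (m i) ?_⟩
  · simpa [latticeVec] using hn i
  · simpa [latticeVec] using hm i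

lemma iUnion_preimage_unitBox :
    ⋃ n, (fun ξ : Plane => ξ - latticeVec n) ⁻¹' unitBox = Set.univ :=
  Set.eq_univ_of_forall fun ξ => Set.mem_iUnion.2 (existsUnique_sub_latticeVec_mem_unitBox ξ).exists

lemma pairwise_disjoint_preimage_unitBox :
    Pairwise (Function.onFun Disjoint fun n =>
      (fun ξ : Plane => ξ - latticeVec n) ⁻¹' unitBox) := fun _ _ hmn =>
  Set.disjoint_left.2 fun ξ hm hn =>
    hmn ((existsUnique_sub_latticeVec_mem_unitBox ξ).unique hm hn)

lemma measurableSet_preimage_unitBox (n : Fin 2 → ℤ) :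
    MeasurableSet ((fun ξ : Plane => ξ - latticeVec n) ⁻¹' unitBox) :=
  (measurable_id.sub_const _) measurableSet_unitBox

lemma lintegral_eq_tsum_unitBox (f : Plane → ℝ≥0∞) :
    ∫⁻ ξ, f ξ = ∑' n, ∫⁻ ξ in unitBox, f (ξ + latticeVec n) := by
  rw [← setLIntegral_univ, ← iUnion_preimage_unitBox,
    lintegral_iUnion measurableSet_preimage_unitBox pairwise_disjoint_preimage_unitBox]
  refine tsum_congr fun n => ?_
  have := (measurePreserving_sub_right volume (latticeVec n)).setLIntegral_comp_preimage_emb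
    (MeasurableEquiv.subRight (latticeVec n)).measurableEmbedding (fun ξ => f (ξ + latticeVec n))
    unitBox
  simpa only [sub_add_cancel] using this

lemma hasSum_integral_unitBox {f : Plane → ℂ} (hf : Integrable f) :
    HasSum (fun n => ∫ ξ in unitBox, f (ξ + latticeVec n)) (∫ ξ, f ξ) := by
  have h := hasSum_integral_iUnion measurableSet_preimage_unitBox
    pairwise_disjoint_preimage_unitBox (f := f) (μ := volume) hf.integrableOn
  rw [iUnion_preimage_unitBox, setIntegral_univ] at h
  refine (funext fun n => ?_ : (fun n => ∫ ξ in unitBox, f (ξ + latticeVec n)) = _) ▸ h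
  have := (measurePreserving_sub_right volume (latticeVec n)).setIntegral_preimage_emb
    (MeasurableEquiv.subRight (latticeVec n)).measurableEmbedding (fun ξ => f (ξ + latticeVec n))
    unitBox
  simpa only [sub_add_cancel] using this.symm

lemma planeWave_latticeVec_eq_mFourier (k : Fin 2 → ℤ) (x : Fin 2 → ℝ) :
    planeWave (latticeVec k) (WithLp.toLp 2 x)
      = UnitAddTorus.mFourier (-k) (fun i => (x i : UnitAddCircle)) := by
  rw [planeWave_eq_exp]
  simp only [UnitAddTorus.mFourier, ContinuousMap.coe_mk, Fin.prod_univ_two, fourier_coe_apply,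
    ← Complex.exp_add]
  congr 1
  simp [PiLp.inner_apply, latticeVec, Fin.sum_univ_two]
  ring

lemma setIntegral_unitBox_eq (f : Plane → ℂ) :
    ∫ ξ in unitBox, f ξ =
      ∫ x in {x : Fin 2 → ℝ | ∀ i, x i ∈ Set.Ioc (-(1 / 2) : ℝ) (-(1 / 2) + 1)},
      f (WithLp.toLp 2 x) := by
  rw [← (PiLp.volume_preserving_toLp (Fin 2)).setIntegral_preimage_emb
    (MeasurableEquiv.toLp 2 (Fin 2 → ℝ)).measurableEmbedding]
  rfl

lemma Continuous.integrableOn_unitBox {f : Plane → ℂ} (hf : Continuous f) :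
    IntegrableOn f unitBox :=
  (hf.continuousOn.integrableOn_compact (isCompact_closedBall 0 2)).mono_set
    (unitBox_subset_ball.trans Metric.ball_subset_closedBall)

/-- A continuous `ℤ²`-periodic function with the Fourier coefficients of `1` is `1`. -/
lemma eq_one_of_setIntegral_planeWave {G : Plane → ℂ} (hG : Continuous G)
    (hper : ∀ ξ n, G (ξ + latticeVec n) = G ξ)
    (hcoeff : ∀ k, ∫ ξ in unitBox, G ξ * planeWave (latticeVec k) ξ = if k = 0 then 1 else 0)
    (ξ : Plane) : G ξ = 1 := by
  -- The quotient map ℝ² → 𝕋² lets the periodic G descend to a continuous function g on the torus.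
  have hq : IsOpenQuotientMap (Pi.map fun _ : Fin 2 => ((↑) : ℝ → UnitAddCircle)) :=
    IsOpenQuotientMap.piMap fun _ => QuotientAddGroup.isOpenQuotientMap_mk
  let f : C(Fin 2 → ℝ, ℂ) := ⟨fun x => G (WithLp.toLp 2 x), by fun_prop⟩
  have hf : Function.FactorsThrough f (Pi.map fun _ : Fin 2 => ((↑) : ℝ → UnitAddCircle)) := by
    intro x y hxy
    have h : ∀ i, ∃ n : ℤ, x i = y i + n := fun i => by
      have h1 : ((x i : ℝ) : UnitAddCircle) = (y i : ℝ) := congrFun hxy i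
      obtain ⟨n, hn⟩ := AddSubgroup.mem_zmultiples_iff.1 (QuotientAddGroup.eq.1 h1)
      refine ⟨-n, ?_⟩
      rw [zsmul_one] at hn
      push_cast
      linarith
    choose n hn using h
    have : (WithLp.toLp 2 x : Plane) = WithLp.toLp 2 y + latticeVec n := by
      ext i; simp [latticeVec, hn]
    show G _ = G _
    rw [this, hper]
  let π : C(Fin 2 → ℝ, UnitAddTorus (Fin 2)) := ⟨_, hq.continuous⟩
  have hπ : IsQuotientMap π := hq.isQuotientMap
  let g : C(UnitAddTorus (Fin 2), ℂ) := hπ.lift f hf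
  have hg : ∀ x : Fin 2 → ℝ, g (fun i => (x i : UnitAddCircle)) = G (WithLp.toLp 2 x) := fun x =>
    DFunLike.congr_fun (hπ.lift_comp f hf) x
  have hc : UnitAddTorus.mFourierCoeff g = fun n => if n = 0 then (1 : ℂ) else 0 := by
    funext n
    rw [UnitAddTorus.mFourierCoeff_eq_integral g n (fun _ => -(1 / 2)), ← hcoeff n,
      setIntegral_unitBox_eq]
    refine integral_congr_ae (Filter.Eventually.of_forall fun x => ?_)
    simp only
    rw [hg, planeWave_latticeVec_eq_mFourier, smul_eq_mul, mul_comm]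
  -- Summable coefficients make the Fourier series of the continuous g converge to it at every
  -- point, hence an identity without exceptional set.
  have hs : Summable (UnitAddTorus.mFourierCoeff g) := by
    rw [hc]
    exact (hasSum_ite_eq (0 : Fin 2 → ℤ) (1 : ℂ)).summable
  have h1 := UnitAddTorus.hasSum_mFourier_series_apply_of_summable hs
    (fun i => (ξ i : UnitAddCircle))
  have h2 : HasSum (fun i => UnitAddTorus.mFourierCoeff g i •
      UnitAddTorus.mFourier i (fun i => (ξ i : UnitAddCircle))) 1 := by
    convert hasSum_ite_eq (0 : Fin 2 → ℤ) (1 : ℂ) using 2 with n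
    rw [hc]
    split_ifs with h
    · simp [h, UnitAddTorus.mFourier_zero]
    · simp [h]
  have h3 := h1.unique h2
  rwa [hg] at h3

/-- The correlations of two reproduced square integrable functions determine their bracket
product everywhere. -/
lemma tsum_mul_conj_eq_one {H H' : Plane → ℂ} (hH : Continuous H) (hH' : Continuous H')
    (hL : MemLp H 2) (hL' : MemLp H' 2)
    {η η' : SchwartzMap Plane ℂ} (h : ∀ ξ, ∫ u, H (ξ - u) * η u = H ξ)
    (h' : ∀ ξ, ∫ u, H' (ξ - u) * η' u = H' ξ)
    (hcorr : ∀ k, ∫ ξ, H ξ * conj (H' ξ) * planeWave (latticeVec k) ξ = if k = 0 then 1 else 0)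
    (ξ : Plane) : ∑' n, H (ξ + latticeVec n) * conj (H' (ξ + latticeVec n)) = 1 := by
  let G : Plane → ℂ := fun ξ => ∑' n, H (ξ + latticeVec n) * conj (H' (ξ + latticeVec n))
  -- A locally uniform summable majorant, from 2|ab| ≤ |a|² + |b|². It gives both continuity of G
  -- and the interchange of sum and integral.
  have hbound : ∀ r : ℝ, ∃ b : (Fin 2 → ℤ) → ℝ, Summable b ∧ ∀ n, ∀ ξ ∈ Metric.ball (0 : Plane) r,
      ‖H (ξ + latticeVec n) * conj (H' (ξ + latticeVec n))‖ ≤ b n := by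
    intro r
    obtain ⟨b, hb, hb'⟩ := exists_summable_bound_of_reproducing hH hL h r
    obtain ⟨c, hc, hc'⟩ := exists_summable_bound_of_reproducing hH' hL' h' r
    refine ⟨fun n => b n + c n, hb.add hc, fun n ξ hξ => ?_⟩
    rw [norm_mul, RCLike.norm_conj]
    nlinarith [hb' n ξ hξ, hc' n ξ hξ, sq_nonneg (‖H (ξ + latticeVec n)‖ -
      ‖H' (ξ + latticeVec n)‖), sq_nonneg ‖H (ξ + latticeVec n)‖,
      sq_nonneg ‖H' (ξ + latticeVec n)‖]
  have hGc : Continuous G := by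
    rw [continuous_iff_continuousAt]
    intro ξ
    obtain ⟨b, hb, hb'⟩ := hbound (‖ξ‖ + 1)
    have : ContinuousOn G (Metric.ball (0 : Plane) (‖ξ‖ + 1)) :=
      continuousOn_tsum (fun n => by fun_prop) hb hb'
    exact this.continuousAt (Metric.isOpen_ball.mem_nhds (by simp))
  have hGp : ∀ ξ n, G (ξ + latticeVec n) = G ξ := by
    intro ξ n
    simp only [G]
    rw [← (Equiv.addLeft n).tsum_eq fun m => H (ξ + latticeVec m) * conj (H' (ξ + latticeVec m))]
    refine tsum_congr fun m => ?_
    rw [Equiv.coe_addLeft, latticeVec_add, add_assoc]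
  refine eq_one_of_setIntegral_planeWave (G := G) hGc hGp (fun k => ?_) ξ
  rw [← hcorr k]
  have hint : Integrable fun ξ => H ξ * conj (H' ξ) * planeWave (latticeVec k) ξ := by
    have h1 : Integrable fun ξ => H ξ * conj (H' ξ) := by
      have := hL.integrable_mul hL'.star
      exact this
    exact h1.mul_bdd (c := 1) (by fun_prop)
      (Filter.Eventually.of_forall fun ξ => (norm_planeWave _ _).le)
  -- Unfolding: the exponential is ℤ²-periodic, so the coefficient of G over the box is the
  -- correlation integral over the plane.
  refine HasSum.unique ?_ (hasSum_integral_unitBox hint)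
  obtain ⟨b, hb, hb'⟩ := hbound 2
  have := hasSum_integral_of_summable_integral_norm (E := ℂ)
    (μ := volume.restrict unitBox)
    (F := fun n ξ => H (ξ + latticeVec n) * conj (H' (ξ + latticeVec n)) *
      planeWave (latticeVec k) (ξ + latticeVec n)) ?_ ?_
  · have e : ∀ ξ, G ξ * planeWave (latticeVec k) ξ
        = ∑' n, H (ξ + latticeVec n) * conj (H' (ξ + latticeVec n)) *
          planeWave (latticeVec k) (ξ + latticeVec n) := fun ξ => by
      simp only [G, planeWave_add_right, planeWave_lattice, mul_one]
      rw [tsum_mul_right]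
    simp only [e]
    exact this
  · intro n
    exact (hint.comp_add_right (latticeVec n)).integrableOn
  · refine hb.of_nonneg_of_le (fun n => integral_nonneg fun ξ => norm_nonneg (_ : ℂ)) fun n => ?_
    have h1 : ∫ _ in unitBox, b n = b n := by simp [Measure.real, volume_unitBox]
    rw [← h1]
    refine setIntegral_mono_on (hint.comp_add_right (latticeVec n)).integrableOn.norm ?_
      measurableSet_unitBox fun ξ hξ => ?_
    · exact integrableOn_const (by simp [volume_unitBox])
    · rw [norm_mul, norm_planeWave, mul_one]
      exact hb' n ξ (unitBox_subset_ball hξ)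

/-! ### Compact fundamental domains built from grid cells. -/

/-- The closed cell with index `a` of the `N × N` grid on the closed unit square. -/
def gridCell (N : ℕ) (a : Fin 2 → Fin N) : Set Plane :=
  WithLp.ofLp ⁻¹' Set.Icc (fun i => -(1 / 2) + (a i : ℝ) / N)
    fun i => -(1 / 2) + ((a i : ℝ) + 1) / N

lemma mem_gridCell {N : ℕ} {a : Fin 2 → Fin N} {ξ : Plane} :
    ξ ∈ gridCell N a ↔
      ∀ i, -(1 / 2) + (a i : ℝ) / N ≤ ξ i ∧ ξ i ≤ -(1 / 2) + ((a i : ℝ) + 1) / N := by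
  simp only [gridCell, Set.mem_preimage, Set.mem_Icc, Pi.le_def, forall_and]

lemma isCompact_gridCell (N : ℕ) (a : Fin 2 → Fin N) : IsCompact (gridCell N a) :=
  (PiLp.homeomorph 2 fun _ : Fin 2 => ℝ).isClosedEmbedding.isCompact_preimage isCompact_Icc

lemma volume_gridCell {N : ℕ} (a : Fin 2 → Fin N) :
    volume (gridCell N a) = ENNReal.ofReal ((1 : ℝ) / N) ^ 2 := by
  rw [gridCell, (PiLp.volume_preserving_ofLp (Fin 2)).measure_preimage
    measurableSet_Icc.nullMeasurableSet, Real.volume_Icc_pi, Fin.prod_univ_two, sq]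
  congr 2 <;> ring

lemma exists_mem_gridCell {N : ℕ} (hN : 0 < N) {ξ : Plane}
    (hξ : ∀ i, -(1 / 2) ≤ ξ i ∧ ξ i ≤ 1 / 2) : ∃ a, ξ ∈ gridCell N a := by
  have hN' : (0 : ℝ) < N := by exact_mod_cast hN
  have h : ∀ i, ∃ a : Fin N, -(1 / 2) + (a : ℝ) / N ≤ ξ i ∧
      ξ i ≤ -(1 / 2) + ((a : ℝ) + 1) / N := by
    intro i
    obtain ⟨h1, h2⟩ := hξ i
    rcases h2.eq_or_lt with h2 | h2
    · refine ⟨⟨N - 1, by omega⟩, ?_⟩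
      have e : ((N - 1 : ℕ) : ℝ) = N - 1 := by push_cast [Nat.one_le_iff_ne_zero.2 hN.ne']; ring
      simp only [e]
      rw [h2, sub_add_cancel, div_self hN'.ne', sub_div, div_self hN'.ne']
      have : 0 < 1 / (N : ℝ) := by positivity
      constructor <;> linarith
    · have h3 : 0 ≤ (ξ i + 1 / 2) * N := mul_nonneg (by linarith) hN'.le
      refine ⟨⟨⌊(ξ i + 1 / 2) * N⌋₊, ?_⟩, ?_, ?_⟩
      · rw [Nat.floor_lt h3]
        nlinarith
      · have := (div_le_iff₀ hN').2 (Nat.floor_le h3)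
        simp only
        linarith
      · have := (le_div_iff₀ hN').2 (Nat.lt_floor_add_one ((ξ i + 1 / 2) * N)).le
        simp only
        linarith
  choose a ha using h
  exact ⟨a, mem_gridCell.2 ha⟩

lemma dist_lt_of_mem_gridCell {N : ℕ} {δ : ℝ} (hδ : 2 / (N : ℝ) < δ) {a : Fin 2 → Fin N}
    {ξ ζ : Plane} (hξ : ξ ∈ gridCell N a) (hζ : ζ ∈ gridCell N a) : dist ξ ζ < δ := by
  refine lt_of_le_of_lt ?_ hδ
  have h : ∀ i, |ξ i - ζ i| ≤ 1 / N := fun i => by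
    have h1 := mem_gridCell.1 hξ i
    have h2 := mem_gridCell.1 hζ i
    rw [add_div] at h1 h2
    rw [abs_le]
    constructor <;> linarith [h1.1, h1.2, h2.1, h2.2]
  have hN : 0 ≤ 1 / (N : ℝ) := by positivity
  rw [EuclideanSpace.dist_eq, Fin.sum_univ_two, Real.dist_eq, Real.dist_eq,
    Real.sqrt_le_left (by positivity), show 2 / (N : ℝ) = 2 * (1 / N) by ring]
  nlinarith [h 0, h 1, abs_nonneg (ξ 0 - ζ 0), abs_nonneg (ξ 1 - ζ 1)]

lemma tsum_indicator_translate_ge {K : Set Plane} (hK : ∀ ξ, ∃ n, ξ + latticeVec n ∈ K)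
    (ξ : Plane) : 1 ≤ ∑' n, K.indicator (1 : Plane → ℝ≥0∞) (ξ + latticeVec n) := by
  obtain ⟨n, hn⟩ := hK ξ
  refine le_trans ?_ (ENNReal.le_tsum n)
  simp [hn]

/-- The integrand is the covering multiplicity of K modulo ℤ². Since it is at least 1 for a covering
set, the area is at least 1, and area 1 forces multiplicity one almost everywhere. -/
lemma lintegral_tsum_indicator_translate {K : Set Plane} (hKm : MeasurableSet K) :
    ∫⁻ ξ in unitBox, ∑' n, K.indicator (1 : Plane → ℝ≥0∞) (ξ + latticeVec n) = volume K := by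
  have hm : Measurable (K.indicator (1 : Plane → ℝ≥0∞)) := measurable_one.indicator hKm
  rw [← lintegral_indicator_one hKm, lintegral_eq_tsum_unitBox,
    lintegral_tsum fun n => by fun_prop]

/-- An open set which contains `0` and covers the plane modulo `ℤ²` contains a compact fundamental
domain which is a neighbourhood of `0`. -/
lemma exists_compact_fundamentalDomain {U : Set Plane} (hU : IsOpen U) (h0 : (0 : Plane) ∈ U)
    (hcov : ∀ ξ, ∃ n, ξ + latticeVec n ∈ U) :
    ∃ K ⊆ U, IsCompact K ∧ K ∈ 𝓝 (0 : Plane) ∧ (∀ ξ, ∃ n, ξ + latticeVec n ∈ K) ∧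
      volume K = 1 := by
  classical
  have hQ : IsCompact ({ξ | ∀ i, -(1 / 2) ≤ ξ i ∧ ξ i ≤ 1 / 2} : Set Plane) := by
    convert (PiLp.homeomorph 2 fun _ : Fin 2 => ℝ).isClosedEmbedding.isCompact_preimage
      (isCompact_Icc (a := fun _ => -(1 / 2)) (b := fun _ => 1 / 2)) using 1
    ext ξ
    exact forall_and
  -- The translates of U cover the closed unit square; below the Lebesgue number δ, each cell fits
  -- in a single translate.
  obtain ⟨δ, hδ, hδ'⟩ := lebesgue_number_lemma_of_metric hQ
    (c := fun n : Fin 2 → ℤ => {ξ | ξ + latticeVec n ∈ U})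
    (fun n => hU.preimage (continuous_id.add continuous_const))
    (fun ξ _ => Set.mem_iUnion.2 (hcov ξ))
  obtain ⟨r, hr, hr'⟩ := Metric.isOpen_iff.1 hU 0 h0
  obtain ⟨N, hN⟩ := exists_nat_gt (2 / min δ r)
  have hmin : 0 < min δ r := lt_min hδ hr
  have hN0 : (0 : ℝ) < N := lt_trans (by positivity) hN
  have hNδ : 2 / (N : ℝ) < min δ r := by
    rw [div_lt_iff₀ hN0, mul_comm]; rwa [div_lt_iff₀ hmin] at hN
  -- Cells containing 0 must stay in place for K to be a neighbourhood of 0; they lie in the ball of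
  -- radius r inside U.
  have hshift : ∀ a : Fin 2 → Fin N, ∃ n : Fin 2 → ℤ,
      (∀ ξ ∈ gridCell N a, ξ + latticeVec n ∈ U) ∧ ((0 : Plane) ∈ gridCell N a → n = 0) := by
    intro a
    by_cases ha : (0 : Plane) ∈ gridCell N a
    · refine ⟨0, fun ξ hξ => ?_, fun _ => rfl⟩
      rw [latticeVec_zero, add_zero]
      exact hr' (Metric.mem_ball.2
        ((dist_lt_of_mem_gridCell hNδ hξ ha).trans_le (min_le_right _ _)))
    · let p : Plane := WithLp.toLp 2 fun i => -(1 / 2) + (a i : ℝ) / N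
      have hp : p ∈ gridCell N a := mem_gridCell.2 fun i => by
        have : (a i : ℝ) / N ≤ ((a i : ℝ) + 1) / N := by gcongr; linarith
        exact ⟨le_rfl, by simpa [p] using this⟩
      have hpQ : p ∈ ({ξ | ∀ i, -(1 / 2) ≤ ξ i ∧ ξ i ≤ 1 / 2} : Set Plane) := fun i => by
        have h1 : (0 : ℝ) ≤ (a i : ℝ) / N := by positivity
        have h2 : (a i : ℝ) / N ≤ 1 := by
          rw [div_le_one hN0]; exact_mod_cast (a i).2.le
        simp only [p]
        constructor <;> linarith
      obtain ⟨n, hn⟩ := hδ' p hpQ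
      refine ⟨n, fun ξ hξ => hn (Metric.mem_ball.2 ?_), fun h => absurd h ha⟩
      exact (dist_lt_of_mem_gridCell hNδ hξ hp).trans_le (min_le_left _ _)
  choose n hn hn0 using hshift
  let K : Set Plane := ⋃ a, (fun ξ => ξ + latticeVec (n a)) '' gridCell N a
  have hKc : IsCompact K := isCompact_iUnion fun a =>
    (isCompact_gridCell N a).image (continuous_id.add continuous_const)
  have hKcov : ∀ ξ, ∃ m, ξ + latticeVec m ∈ K := by
    intro ξ
    obtain ⟨m, hm, -⟩ := existsUnique_sub_latticeVec_mem_unitBox ξ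
    obtain ⟨a, ha⟩ := exists_mem_gridCell (N := N) (by exact_mod_cast hN0)
      (ξ := ξ - latticeVec m) fun i => by
        have := hm i
        rw [Set.mem_Ioc] at this
        constructor <;> linarith [this.1, this.2]
    refine ⟨n a - m, Set.mem_iUnion.2 ⟨a, _, ha, ?_⟩⟩
    simp only
    rw [latticeVec_sub]
    abel
  refine ⟨K, ?_, hKc, ?_, hKcov, le_antisymm ?_ ?_⟩
  · refine Set.iUnion_subset fun a => ?_
    rintro _ ⟨ξ, hξ, rfl⟩
    exact hn a ξ hξ
  · have h1 : ∀ᶠ ξ in 𝓝 (0 : Plane), ∀ a, (0 : Plane) ∉ gridCell N a → ξ ∉ gridCell N a := by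
      rw [Filter.eventually_all]
      intro a
      by_cases ha : (0 : Plane) ∈ gridCell N a
      · exact Filter.Eventually.of_forall fun _ h => absurd ha h
      · filter_upwards [(isCompact_gridCell N a).isClosed.isOpen_compl.mem_nhds ha] with ξ hξ _
        exact hξ
    filter_upwards [h1, Metric.ball_mem_nhds (0 : Plane) (show (0 : ℝ) < 1 / 2 by norm_num)]
      with ξ h1 h2
    obtain ⟨a, ha⟩ := exists_mem_gridCell (N := N) (by exact_mod_cast hN0) (ξ := ξ) fun i => by
      have h3 := PiLp.norm_apply_le (p := 2) ξ i
      rw [mem_ball_zero_iff] at h2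
      rw [Real.norm_eq_abs] at h3
      exact abs_le.1 (h3.trans h2.le)
    have h0a : (0 : Plane) ∈ gridCell N a := by
      by_contra h
      exact h1 a h ha
    exact Set.mem_iUnion.2 ⟨a, ξ, ha, by simp [hn0 a h0a]⟩
  -- N² cells of area N⁻² give area at most 1; covering gives the reverse inequality.
  · refine (measure_iUnion_le _).trans ?_
    have h1 : ∀ a, volume ((fun ξ => ξ + latticeVec (n a)) '' gridCell N a)
        = ENNReal.ofReal ((1 : ℝ) / N) ^ 2 := fun a => by
      rw [← volume_gridCell a]
      rw [Set.image_add_right, measure_preimage_add_right]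
    simp only [h1, tsum_fintype, Finset.sum_const, Finset.card_univ, Fintype.card_fun,
      Fintype.card_fin, nsmul_eq_mul]
    rw [← ENNReal.ofReal_pow (by positivity), ← ENNReal.ofReal_natCast,
      ← ENNReal.ofReal_mul (by positivity)]
    simp [hN0.ne']
  · rw [← lintegral_tsum_indicator_translate hKc.measurableSet]
    calc (1 : ℝ≥0∞) = ∫⁻ _ in unitBox, 1 := by simp [volume_unitBox]
      _ ≤ _ := lintegral_mono fun ξ => tsum_indicator_translate_ge hKcov ξ

/-- Integrals of periodic functions over a set of area one covering the plane modulo `ℤ²`. -/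
lemma setIntegral_eq_setIntegral_unitBox {K : Set Plane} (hKc : IsCompact K)
    (hcov : ∀ ξ, ∃ n, ξ + latticeVec n ∈ K) (hvol : volume K = 1) {f : Plane → ℂ}
    (hf : Continuous f) (hper : ∀ ξ n, f (ξ + latticeVec n) = f ξ) :
    ∫ ξ in K, f ξ = ∫ ξ in unitBox, f ξ := by
  have hKm := hKc.measurableSet
  let c : Plane → ℝ≥0∞ := fun ξ => ∑' n, K.indicator (1 : Plane → ℝ≥0∞) (ξ + latticeVec n)
  have hm : Measurable (K.indicator (1 : Plane → ℝ≥0∞)) := measurable_one.indicator hKm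
  -- A multiplicity that is at least 1 and has integral 1 over the box equals 1 almost everywhere,
  -- so the sets `A n` below partition the box up to null sets.
  have hc : (fun _ => 1) =ᵐ[volume.restrict unitBox] c :=
    ae_eq_of_ae_le_of_lintegral_le
      (Filter.Eventually.of_forall fun ξ => tsum_indicator_translate_ge hcov ξ)
      (by simp [volume_unitBox]) (by fun_prop)
      (by rw [lintegral_tsum_indicator_translate hKm, hvol]; simp [volume_unitBox])
  let A : (Fin 2 → ℤ) → Set Plane := fun n => (fun ξ => ξ + latticeVec n) ⁻¹' K
  have hA : ∀ n, MeasurableSet (A n) := fun n => (measurable_id.add_const _) hKm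
  have hAu : ⋃ n, A n = Set.univ := Set.eq_univ_of_forall fun ξ => Set.mem_iUnion.2 (hcov ξ)
  have hAd : Pairwise (Function.onFun (AEDisjoint (volume.restrict unitBox)) A) := by
    intro m n hmn
    refine measure_mono_null (fun ξ hξ => ?_) hc
    obtain ⟨h1, h2⟩ := hξ
    intro h
    have h3 := ENNReal.sum_le_tsum (f := fun n => K.indicator (1 : Plane → ℝ≥0∞)
      (ξ + latticeVec n)) {m, n}
    rw [Finset.sum_pair hmn, Set.indicator_of_mem (Set.mem_preimage.1 h1),
      Set.indicator_of_mem (Set.mem_preimage.1 h2)] at h3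
    replace h : 1 = c ξ := h
    have h4 : (1 : ℝ≥0∞) + 1 ≤ 1 := h3.trans h.ge
    exact absurd h4 (by norm_num)
  have hs1 := hasSum_integral_iUnion_ae (fun n => (hA n).nullMeasurableSet) hAd
    (f := f) (by rw [hAu]; exact hf.integrableOn_unitBox.integrableOn)
  rw [hAu, setIntegral_univ] at hs1
  have hs2 := hasSum_integral_unitBox (f := K.indicator f)
    ((integrable_indicator_iff hKm).2 (hf.continuousOn.integrableOn_compact hKc))
  rw [integral_indicator hKm] at hs2
  refine hs2.unique ?_
  have e : ∀ n, ∫ ξ in unitBox, K.indicator f (ξ + latticeVec n)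
      = ∫ ξ in A n, f ξ ∂(volume.restrict unitBox) := fun n => by
    rw [← integral_indicator (hA n)]
    refine integral_congr_ae (Filter.Eventually.of_forall fun ξ => ?_)
    beta_reduce
    by_cases h : ξ + latticeVec n ∈ K
    · rw [Set.indicator_of_mem h, Set.indicator_of_mem (show ξ ∈ A n from h), hper]
    · rw [Set.indicator_of_notMem h, Set.indicator_of_notMem (show ξ ∉ A n from h)]
  simp only [e]
  exact hs1

/-! ### Mean values of periodic functions and the transfer operator. -/

lemma setIntegral_unitBox_planeWave (k : Fin 2 → ℤ) :
    ∫ ξ in unitBox, planeWave (latticeVec k) ξ = if k = 0 then 1 else 0 := by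
  classical
  have h1 := UnitAddTorus.mFourierBasis_repr (UnitAddTorus.mFourierLp 2 (-k)) 0
  rw [← UnitAddTorus.coe_mFourierBasis, HilbertBasis.repr_self, UnitAddTorus.coe_mFourierBasis,
    UnitAddTorus.mFourierCoeff_toLp,
    UnitAddTorus.mFourierCoeff_eq_integral _ _ (fun _ => -(1 / 2))] at h1
  rw [setIntegral_unitBox_eq]
  simp only [neg_zero, UnitAddTorus.mFourier_zero, ContinuousMap.one_apply, one_smul,
    ← planeWave_latticeVec_eq_mFourier] at h1
  rw [← h1, lp.single_apply, Pi.single_apply]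
  simp [eq_comm]

/-- By linearity, invariance of the mean under T need only be checked on exponentials; T will be a
doubling or a translation. -/
lemma setIntegral_unitBox_comp {T : Plane → Plane} (hT : Continuous T)
    (h : ∀ k, ∫ ξ in unitBox, planeWave (latticeVec k) (T ξ)
      = ∫ ξ in unitBox, planeWave (latticeVec k) ξ) {f : Plane → ℂ} (hf : f ∈ latticeSpan) :
    ∫ ξ in unitBox, f (T ξ) = ∫ ξ in unitBox, f ξ := by
  suffices Continuous f ∧ ∫ ξ in unitBox, f (T ξ) = ∫ ξ in unitBox, f ξ from this.2
  refine trigSpan_induction (p := fun f : Plane → ℂ => Continuous f ∧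
    ∫ ξ in unitBox, f (T ξ) = ∫ ξ in unitBox, f ξ) ?_ ⟨continuous_zero, by simp⟩ ?_ ?_ hf
  · rintro _ ⟨k, rfl⟩
    exact ⟨continuous_planeWave _, h k⟩
  · rintro f g ⟨hf, hf'⟩ ⟨hg, hg'⟩
    refine ⟨hf.add hg, ?_⟩
    have hfT : Integrable (fun ξ => f (T ξ)) (volume.restrict unitBox) :=
      (hf.comp hT).integrableOn_unitBox
    have hgT : Integrable (fun ξ => g (T ξ)) (volume.restrict unitBox) :=
      (hg.comp hT).integrableOn_unitBox
    simp only [Pi.add_apply]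
    rw [integral_add hfT hgT, integral_add hf.integrableOn_unitBox hg.integrableOn_unitBox, hf', hg']
  · rintro c f ⟨hf, hf'⟩
    refine ⟨hf.const_smul c, ?_⟩
    simp only [Pi.smul_apply]
    rw [integral_smul, integral_smul, hf']

lemma setIntegral_unitBox_comp_two_smul {f : Plane → ℂ} (hf : f ∈ latticeSpan) :
    ∫ ξ in unitBox, f ((2 : ℝ) • ξ) = ∫ ξ in unitBox, f ξ := by
  refine setIntegral_unitBox_comp (continuous_const_smul _) (fun k => ?_) hf
  have h2 := natCast_smul_latticeVec 2 k
  push_cast at h2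
  simp only [planeWave_smul_right, h2]
  rw [setIntegral_unitBox_planeWave, setIntegral_unitBox_planeWave]
  have : (2 : ℤ) • k = 0 ↔ k = 0 := smul_eq_zero.trans (or_iff_right two_ne_zero)
  simp only [this]

lemma setIntegral_unitBox_comp_add (a : Plane) {f : Plane → ℂ} (hf : f ∈ latticeSpan) :
    ∫ ξ in unitBox, f (ξ + a) = ∫ ξ in unitBox, f ξ := by
  refine setIntegral_unitBox_comp (continuous_add_const a) (fun k => ?_) hf
  simp only [planeWave_add_right]
  rw [integral_mul_const, setIntegral_unitBox_planeWave]
  split_ifs with hk <;> simp [hk]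

/-- One step of the transfer operator does not change the mean value. -/
lemma card_mul_setIntegral_unitBox {P : Finset Plane} (hP : ∀ p ∈ P, ∃ n, (2 : ℝ) • p = latticeVec n)
    {q r : Plane → ℂ} (hq : q ∈ latticeSpan) (hr : r ∈ latticeSpan)
    (hsum : ∀ ξ, ∑ p ∈ P, q (ξ + p) = 1) :
    (P.card : ℂ) * ∫ ξ in unitBox, q ξ * r ((2 : ℝ) • ξ) = ∫ ξ in unitBox, r ξ := by
  have hr2 : (fun ξ => r ((2 : ℝ) • ξ)) ∈ latticeSpan := by
    simpa using latticeSpan_comp_natCast_smul 2 hr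
  have hqr := latticeSpan_mul hq hr2
  have hc := continuous_of_mem_trigSpan hqr
  -- Average over the shifts p: since 2p is a lattice vector, r(2·) is unchanged, and the values of
  -- q add up to 1.
  calc (P.card : ℂ) * ∫ ξ in unitBox, q ξ * r ((2 : ℝ) • ξ)
      = ∑ p ∈ P, ∫ ξ in unitBox, (q * fun ξ => r ((2 : ℝ) • ξ)) (ξ + p) := by
        rw [Finset.sum_congr rfl fun p _ => setIntegral_unitBox_comp_add p hqr, Finset.sum_const,
          nsmul_eq_mul]
        rfl
    _ = ∫ ξ in unitBox, ∑ p ∈ P, (q * fun ξ => r ((2 : ℝ) • ξ)) (ξ + p) :=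
        (integral_finsetSum _ fun p _ =>
          (hc.comp (continuous_add_const p)).integrableOn_unitBox).symm
    _ = ∫ ξ in unitBox, r ((2 : ℝ) • ξ) := by
        refine integral_congr_ae (Filter.Eventually.of_forall fun ξ => ?_)
        simp only [Pi.mul_apply]
        rw [← one_mul (r _), ← hsum ξ, Finset.sum_mul]
        refine Finset.sum_congr rfl fun p hp => ?_
        obtain ⟨n, hn⟩ := hP p hp
        rw [smul_add, hn, latticeSpan_periodic hr]
    _ = _ := setIntegral_unitBox_comp_two_smul hr

/-- The partial product of a mask, modulated by an exponential and rescaled to period `ℤ²`. -/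
noncomputable def rescaledPartial (q : Plane → ℂ) (n : Fin 2 → ℤ) (N : ℕ) (ξ : Plane) : ℂ :=
  partialMask q N ((2 : ℝ) ^ N • ξ) * planeWave (latticeVec n) ((2 : ℝ) ^ N • ξ)

/-- After rescaling, the last factor of the product becomes q(ξ): this is the recursion on which a
transfer step acts. -/
lemma rescaledPartial_succ (q : Plane → ℂ) (n : Fin 2 → ℤ) (N : ℕ) (ξ : Plane) :
    rescaledPartial q n (N + 1) ξ = q ξ * rescaledPartial q n N ((2 : ℝ) • ξ) := by
  have h : (2 : ℝ)⁻¹ ^ (N + 1) • (2 : ℝ) ^ (N + 1) • ξ = ξ := by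
    rw [smul_smul, ← mul_pow, inv_mul_cancel₀ two_ne_zero, one_pow, one_smul]
  simp only [rescaledPartial, partialMask, Finset.prod_range_succ, h]
  simp only [smul_smul, pow_succ]
  ring

lemma rescaledPartial_mem {q : Plane → ℂ} (hq : q ∈ latticeSpan) (n : Fin 2 → ℤ) (N : ℕ) :
    rescaledPartial q n N ∈ latticeSpan := by
  induction N with
  | zero =>
    convert planeWave_lattice_mem n using 1
    funext ξ; simp [rescaledPartial, partialMask]
  | succ N ih =>
    have h2 := latticeSpan_mul hq (latticeSpan_comp_natCast_smul 2 ih)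
    convert h2 using 1
    funext ξ; rw [rescaledPartial_succ]; simp

lemma pow_card_mul_setIntegral_rescaledPartial {P : Finset Plane}
    (hP : ∀ p ∈ P, ∃ n, (2 : ℝ) • p = latticeVec n) {q : Plane → ℂ} (hq : q ∈ latticeSpan)
    (hsum : ∀ ξ, ∑ p ∈ P, q (ξ + p) = 1) (n : Fin 2 → ℤ) (N : ℕ) :
    (P.card : ℂ) ^ N * ∫ ξ in unitBox, rescaledPartial q n N ξ = if n = 0 then 1 else 0 := by
  induction N with
  | zero =>
    rw [pow_zero, one_mul, ← setIntegral_unitBox_planeWave]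
    simp [rescaledPartial, partialMask]
  | succ N ih =>
    simp only [rescaledPartial_succ]
    rw [pow_succ, mul_assoc, card_mul_setIntegral_unitBox hP hq (rescaledPartial_mem hq n N) hsum,
      ih]

/-- The truncated products restricted to a dilated fundamental domain are biorthogonal. -/
lemma integral_indicator_partialMask {P : Finset Plane} (hcard : P.card = 4)
    (hP : ∀ p ∈ P, ∃ n, (2 : ℝ) • p = latticeVec n) {q : Plane → ℂ} (hq : q ∈ latticeSpan)
    (hsum : ∀ ξ, ∑ p ∈ P, q (ξ + p) = 1) {K : Set Plane} (hKc : IsCompact K)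
    (hcov : ∀ ξ, ∃ n, ξ + latticeVec n ∈ K) (hvol : volume K = 1) (n : Fin 2 → ℤ) (N : ℕ) :
    ∫ ξ, K.indicator (1 : Plane → ℂ) ((2 : ℝ)⁻¹ ^ N • ξ) *
      (partialMask q N ξ * planeWave (latticeVec n) ξ) = if n = 0 then 1 else 0 := by
  have h1 : ∀ ξ, K.indicator (1 : Plane → ℂ) ((2 : ℝ)⁻¹ ^ N • ξ) *
      (partialMask q N ξ * planeWave (latticeVec n) ξ)
      = K.indicator (rescaledPartial q n N) ((2 : ℝ)⁻¹ ^ N • ξ) := by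
    intro ξ
    have h : (2 : ℝ) ^ N • (2 : ℝ)⁻¹ ^ N • ξ = ξ := by
      rw [smul_smul, ← mul_pow, mul_inv_cancel₀ two_ne_zero, one_pow, one_smul]
    by_cases hξ : (2 : ℝ)⁻¹ ^ N • ξ ∈ K
    · rw [Set.indicator_of_mem hξ, Set.indicator_of_mem hξ, rescaledPartial, h, Pi.one_apply,
        one_mul]
    · rw [Set.indicator_of_notMem hξ, Set.indicator_of_notMem hξ, zero_mul]
  have hmem := rescaledPartial_mem hq n N
  simp only [h1]
  -- The Jacobian 4ᴺ of the dilation is exactly the factor `P.card ^ N` of the transfer steps;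
  -- periodicity replaces K by the box.
  rw [Measure.integral_comp_smul, integral_indicator hKc.measurableSet,
    setIntegral_eq_setIntegral_unitBox hKc hcov hvol (continuous_of_mem_trigSpan hmem)
      (latticeSpan_periodic hmem), ← pow_card_mul_setIntegral_rescaledPartial hP hq hsum n N, hcard,
    Complex.real_smul]
  congr 1
  rw [abs_of_pos (by positivity), finrank_euclideanSpace_fin, inv_pow, inv_pow, inv_inv, ← pow_mul,
    mul_comm, pow_mul]
  norm_num

/-! ### Passage to the limit in the truncated correlations. -/

lemma partialMask_mul_conj (M M' : Plane → ℂ) (N : ℕ) (ξ : Plane) :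
    partialMask (fun ξ => M ξ * conj (M' ξ)) N ξ
      = partialMask M N ξ * conj (partialMask M' N ξ) := by
  simp only [partialMask, Finset.prod_mul_distrib, map_prod]

/-- Lower bound for a nonvanishing continuous function on a compact set. -/
lemma IsCompact.exists_pos_le_norm {K : Set Plane} (hK : IsCompact K) {f : Plane → ℂ}
    (hf : Continuous f) (h : ∀ ξ ∈ K, f ξ ≠ 0) : ∃ c, 0 < c ∧ ∀ ξ ∈ K, c ≤ ‖f ξ‖ := by
  rcases K.eq_empty_or_nonempty with rfl | hne
  · exact ⟨1, one_pos, by simp⟩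
  · obtain ⟨ξ, hξ, hmin⟩ := hK.exists_isMinOn hne hf.norm.continuousOn
    exact ⟨‖f ξ‖, norm_pos_iff.2 (h ξ hξ), fun ζ hζ => hmin hζ⟩

/-- The correlations of the limit products, obtained from the truncated products by dominated
convergence. -/
lemma integral_infiniteMask_mul_conj {P : Finset Plane} (hcard : P.card = 4)
    (hP : ∀ p ∈ P, ∃ n, (2 : ℝ) • p = latticeVec n) {M M' : Plane → ℂ} (hM : M ∈ latticeSpan)
    (hM' : M' ∈ latticeSpan) (h0 : M 0 = 1) (h0' : M' 0 = 1)
    (hsum : ∀ ξ, ∑ p ∈ P, M (ξ + p) * conj (M' (ξ + p)) = 1)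
    (hL : MemLp (infiniteMask M) 2) (hL' : MemLp (infiniteMask M') 2)
    (hne : ∀ ξ, ∃ n, infiniteMask M (ξ + latticeVec n) * infiniteMask M' (ξ + latticeVec n) ≠ 0)
    (n : Fin 2 → ℤ) :
    ∫ ξ, infiniteMask M ξ * conj (infiniteMask M' ξ) * planeWave (latticeVec n) ξ
      = if n = 0 then 1 else 0 := by
  have hH := continuous_infiniteMask hM h0
  have hH' := continuous_infiniteMask hM' h0'
  obtain ⟨K, hKU, hKc, hK0, hcov, hvol⟩ := exists_compact_fundamentalDomain
    (U := {ξ | infiniteMask M ξ * infiniteMask M' ξ ≠ 0})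
    ((hH.mul hH').isOpen_preimage _ isOpen_ne)
    (by simp [infiniteMask_zero h0, infiniteMask_zero h0']) hne
  obtain ⟨c, hc0, hc⟩ := hKc.exists_pos_le_norm (hH.mul hH') hKU
  have hq : (fun ξ => M ξ * conj (M' ξ)) ∈ latticeSpan :=
    latticeSpan_mul hM (latticeSpan_conj hM')
  have hcM := continuous_of_mem_trigSpan hM
  have hcM' := continuous_of_mem_trigSpan hM'
  have hlim : Filter.Tendsto (fun N => ∫ ξ, K.indicator (1 : Plane → ℂ) ((2 : ℝ)⁻¹ ^ N • ξ) *
      (partialMask (fun ξ => M ξ * conj (M' ξ)) N ξ * planeWave (latticeVec n) ξ)) Filter.atTop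
      (𝓝 (∫ ξ, infiniteMask M ξ * conj (infiniteMask M' ξ) * planeWave (latticeVec n) ξ)) := by
    -- If 2⁻ᴺξ ∈ K, then |H·H′|(ξ) is the modulus of the truncated product times |H·H′|(2⁻ᴺξ) ≥ c,
    -- whence the majorant |H·H′|/c.
    refine tendsto_integral_of_dominated_convergence
      (fun ξ => ‖infiniteMask M ξ * conj (infiniteMask M' ξ)‖ / c) (fun N => ?_) ?_
      (fun N => Filter.Eventually.of_forall fun ξ => ?_)
      (Filter.Eventually.of_forall fun ξ => ?_)
    · have h1 : Measurable (K.indicator (1 : Plane → ℂ)) :=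
        measurable_one.indicator hKc.measurableSet
      have h2 : Continuous (partialMask (fun ξ => M ξ * conj (M' ξ)) N) :=
        continuous_partialMask (by fun_prop) N
      exact Measurable.aestronglyMeasurable (by fun_prop)
    · have h1 : Integrable fun ξ => infiniteMask M ξ * conj (infiniteMask M' ξ) :=
        hL.integrable_mul hL'.star
      exact h1.norm.div_const c
    · by_cases hξ : (2 : ℝ)⁻¹ ^ N • ξ ∈ K
      · rw [Set.indicator_of_mem hξ, Pi.one_apply, one_mul, norm_mul, norm_planeWave, mul_one,
          partialMask_mul_conj, le_div_iff₀ hc0, infiniteMask_eq_partialMask_mul hM h0 N ξ,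
          infiniteMask_eq_partialMask_mul hM' h0' N ξ]
        have h1 := hc _ hξ
        rw [Pi.mul_apply, norm_mul] at h1
        simp only [norm_mul, RCLike.norm_conj]
        calc _ ≤ ‖partialMask M N ξ‖ * ‖partialMask M' N ξ‖ *
              (‖infiniteMask M ((2 : ℝ)⁻¹ ^ N • ξ)‖ * ‖infiniteMask M' ((2 : ℝ)⁻¹ ^ N • ξ)‖) := by
              gcongr
          _ = _ := by ring
      · rw [Set.indicator_of_notMem hξ, zero_mul, norm_zero]
        positivity
    · have h1 : Filter.Tendsto (fun N : ℕ => (2 : ℝ)⁻¹ ^ N • ξ) Filter.atTop (𝓝 0) := by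
        have := (tendsto_pow_atTop_nhds_zero_of_lt_one (r := (2 : ℝ)⁻¹) (by norm_num)
          (by norm_num)).smul_const ξ
        rwa [zero_smul] at this
      have h2 : Filter.Tendsto (fun N => partialMask M N ξ * conj (partialMask M' N ξ) *
          planeWave (latticeVec n) ξ) Filter.atTop
          (𝓝 (infiniteMask M ξ * conj (infiniteMask M' ξ) * planeWave (latticeVec n) ξ)) :=
        ((tendsto_partialMask hM h0 ξ).mul ((Complex.continuous_conj.tendsto _).comp
          (tendsto_partialMask hM' h0' ξ))).mul_const _
      refine h2.congr' ?_
      -- K is a neighbourhood of 0, so the cut-off at a fixed ξ is eventually 1.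
      filter_upwards [h1.eventually hK0] with N hN
      rw [Set.indicator_of_mem hN, Pi.one_apply, one_mul, partialMask_mul_conj]
  simp only [integral_indicator_partialMask hcard hP hq hsum hKc hcov hvol n] at hlim
  exact tendsto_nhds_unique hlim tendsto_const_nhds

/-! ### Return to the original masks and the two implications. -/

/-- The mask in the frequency variable `ξ = ω / 2π`. -/
noncomputable def rescaledMask (m : Plane → ℂ) (ξ : Plane) : ℂ := m ((2 * Real.pi) • ξ)

lemma IsTrigPolynomial.rescaledMask_mem {m : Plane → ℂ} (hm : IsTrigPolynomial m) :
    rescaledMask m ∈ latticeSpan := hm.comp_two_pi_smul_mem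

lemma rescaledMask_zero {m : Plane → ℂ} (h0 : m 0 = 1) : rescaledMask m 0 = 1 := by
  rw [rescaledMask, smul_zero, h0]

lemma two_pi_ne_zero : (2 * Real.pi : ℝ) ≠ 0 := by positivity

lemma two_pi_smul_inv_smul (ω : Plane) : (2 * Real.pi) • (2 * Real.pi)⁻¹ • ω = ω :=
  smul_inv_smul₀ two_pi_ne_zero ω

lemma scalingHat_two_pi_smul (m : Plane → ℂ) (ξ : Plane) :
    scalingHat m ((2 * Real.pi) • ξ)
      = ((2 * Real.pi)⁻¹ : ℝ) * infiniteMask (rescaledMask m) ξ := by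
  simp only [scalingHat, infiniteMask, rescaledMask, dilateInv, smul_comm (2 * Real.pi)]

lemma HasRefinementMask.fourier_ae_eq {φ : Lp ℂ 2 (volume : Measure Plane)} {m : Plane → ℂ}
    (h : HasRefinementMask φ m) :
    (𝓕 φ : Lp ℂ 2 (volume : Measure Plane)) =ᵐ[volume] infiniteMask (rescaledMask m) := by
  have h1 : ∀ᵐ ξ : Plane, ((2 * Real.pi)⁻¹ : ℝ) *
      (𝓕 φ : Lp ℂ 2 (volume : Measure Plane)) ((2 * Real.pi)⁻¹ • (2 * Real.pi) • ξ)
        = scalingHat m ((2 * Real.pi) • ξ) := by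
    rw [HasRefinementMask, ae_iff] at h
    rw [ae_iff]
    have h2 := Measure.addHaar_preimage_smul (volume : Measure Plane) two_pi_ne_zero
      {ω | ¬((2 * Real.pi)⁻¹ : ℝ) *
        (𝓕 φ : Lp ℂ 2 (volume : Measure Plane)) ((2 * Real.pi)⁻¹ • ω) = scalingHat m ω}
    rw [h, mul_zero] at h2
    exact h2
  filter_upwards [h1] with ξ hξ
  rw [inv_smul_smul₀ two_pi_ne_zero, scalingHat_two_pi_smul] at hξ
  exact mul_left_cancel₀ (Complex.ofReal_ne_zero.2 (inv_ne_zero two_pi_ne_zero)) hξ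

lemma HasRefinementMask.memLp {φ : Lp ℂ 2 (volume : Measure Plane)} {m : Plane → ℂ}
    (h : HasRefinementMask φ m) : MemLp (infiniteMask (rescaledMask m)) 2 :=
  (memLp_congr_ae h.fourier_ae_eq).1 (Lp.memLp _)

lemma integral_translates_eq {φ φ' : Lp ℂ 2 (volume : Measure Plane)} {m m' : Plane → ℂ}
    (h : HasRefinementMask φ m) (h' : HasRefinementMask φ' m') (k k' : Fin 2 → ℤ) :
    ∫ x, φ (x - latticeVec k) * conj (φ' (x - latticeVec k'))
      = ∫ ξ, infiniteMask (rescaledMask m) ξ * conj (infiniteMask (rescaledMask m') ξ) *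
        planeWave (latticeVec (k - k')) ξ := by
  rw [integral_translate_mul_conj_translate, latticeVec_sub]
  refine integral_congr_ae ?_
  filter_upwards [h.fourier_ae_eq, h'.fourier_ae_eq] with ξ h1 h2
  rw [h1, h2]

/-- By Plancherel the inner products depend only on k − k′, and the normalizing factors 2π cancel in
the variable ξ. -/
lemma biorthogonalTranslates_iff {φ φ' : Lp ℂ 2 (volume : Measure Plane)} {m m' : Plane → ℂ}
    (h : HasRefinementMask φ m) (h' : HasRefinementMask φ' m') :
    BiorthogonalTranslates φ φ' ↔
      ∀ k, ∫ ξ, infiniteMask (rescaledMask m) ξ * conj (infiniteMask (rescaledMask m') ξ) *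
        planeWave (latticeVec k) ξ = if k = 0 then 1 else 0 := by
  simp only [BiorthogonalTranslates, integral_translates_eq h h']
  refine ⟨fun H k => ?_, fun H k k' => ?_⟩
  · simpa using H k 0
  · simp only [H, sub_eq_zero]

lemma volume_freqSquare : volume freqSquare = ENNReal.ofReal ((2 * Real.pi) ^ 2) := by
  have h : freqSquare = WithLp.ofLp ⁻¹'
      Set.univ.pi fun _ : Fin 2 => Set.Ico (-Real.pi) Real.pi := by
    ext ξ; simp [freqSquare]
  rw [h, (PiLp.volume_preserving_ofLp (Fin 2)).measure_preimage
    (MeasurableSet.univ_pi fun _ => measurableSet_Ico).nullMeasurableSet, Real.volume_pi_Ico,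
    Fin.prod_univ_two, ← ENNReal.ofReal_mul (by linarith [Real.pi_pos])]
  congr 1
  ring

lemma exists_sub_mem_freqSquare (ω : Plane) :
    ∃ n, ω - (2 * Real.pi) • latticeVec n ∈ freqSquare := by
  have h := fun i => (existsUnique_sub_zsmul_mem_Ico Real.two_pi_pos (ω i) (-Real.pi)).exists
  choose n hn using h
  refine ⟨n, fun i => ?_⟩
  have h1 := hn i
  rw [Set.mem_Ico, zsmul_eq_mul, mul_comm] at h1
  refine ⟨h1.1, ?_⟩
  have h2 : (ω - (2 * Real.pi) • latticeVec n) i = ω i - 2 * Real.pi * n i := by simp [latticeVec]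
  rw [h2]
  linarith [h1.2]

lemma CoversFreqSquare.exists_two_pi_smul_mem {K : Set Plane} (hK : CoversFreqSquare K)
    (ξ : Plane) : ∃ n, (2 * Real.pi) • (ξ + latticeVec n) ∈ K := by
  obtain ⟨k, hk⟩ := exists_sub_mem_freqSquare ((2 * Real.pi) • ξ)
  obtain ⟨n, hn⟩ := hK _ hk
  refine ⟨n - k, ?_⟩
  convert hn using 1
  rw [latticeVec_sub, smul_add, smul_sub]
  abel

lemma PosInfOn.apply_ne_zero {m : Plane → ℂ} {K : Set Plane} (h : PosInfOn m K) {ω : Plane}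
    (hω : ω ∈ K) {k : ℕ} (hk : 0 < k) : m (dilateInv k ω) ≠ 0 := by
  have hb : BddBelow (Set.range fun p : ℕ+ × K => ‖m (dilateInv (p.1 : ℕ) (p.2 : Plane))‖) :=
    ⟨0, by rintro _ ⟨p, rfl⟩; exact norm_nonneg _⟩
  exact norm_pos_iff.1 (h.trans_le (ciInf_le hb (⟨k, hk⟩, ⟨ω, hω⟩)))

/-- The infinite product does not vanish where none of its factors does. -/
lemma infiniteMask_ne_zero {X : Set Plane} {M : Plane → ℂ} (hM : M ∈ trigSpan X) (h0 : M 0 = 1)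
    {ξ : Plane} (h : ∀ j : ℕ, M ((2 : ℝ)⁻¹ ^ (j + 1) • ξ) ≠ 0) : infiniteMask M ξ ≠ 0 := by
  -- The tail after N factors is H(2⁻ᴺξ) → H(0) = 1, so some tail is nonzero and only finitely many
  -- factors remain.
  have h1 : Filter.Tendsto (fun N : ℕ => infiniteMask M ((2 : ℝ)⁻¹ ^ N • ξ)) Filter.atTop
      (𝓝 1) := by
    have h2 := (tendsto_pow_atTop_nhds_zero_of_lt_one (r := (2 : ℝ)⁻¹) (by norm_num)
      (by norm_num)).smul_const ξ
    have h3 := ((continuous_infiniteMask hM h0).tendsto _).comp h2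
    rwa [zero_smul, infiniteMask_zero h0] at h3
  obtain ⟨N, hN⟩ := (h1.eventually_ne one_ne_zero).exists
  rw [infiniteMask_eq_partialMask_mul hM h0 N ξ]
  exact mul_ne_zero (Finset.prod_ne_zero_iff.2 fun j _ => h j) hN

lemma PosInfOn.infiniteMask_ne_zero {m : Plane → ℂ} (hm : IsTrigPolynomial m) (h0 : m 0 = 1)
    {K : Set Plane} (h : PosInfOn m K) {ξ : Plane} (hξ : (2 * Real.pi) • ξ ∈ K) :
    infiniteMask (rescaledMask m) ξ ≠ 0 := by
  refine _root_.infiniteMask_ne_zero hm.rescaledMask_mem (rescaledMask_zero h0) fun j => ?_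
  rw [rescaledMask, smul_comm]
  exact h.apply_ne_zero hξ j.succ_pos

open scoped Pointwise in
-- In H(ξ) = (first j factors)·M(2⁻⁽ʲ⁺¹⁾ξ)·H(2⁻⁽ʲ⁺¹⁾ξ) the two outer terms are bounded on K
-- uniformly in j, so |H| ≥ c bounds the middle factor below.
lemma posInfOn_two_pi_smul {m : Plane → ℂ} (hm : IsTrigPolynomial m) (h0 : m 0 = 1)
    {K : Set Plane} (hK : IsCompact K) (hne : K.Nonempty)
    (h : ∀ ξ ∈ K, infiniteMask (rescaledMask m) ξ ≠ 0) :
    PosInfOn m ((2 * Real.pi) • K) := by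
  have hM := hm.rescaledMask_mem
  have hM0 := rescaledMask_zero h0
  obtain ⟨c, hc0, hc⟩ := hK.exists_pos_le_norm (continuous_infiniteMask hM hM0) h
  obtain ⟨R, hR⟩ := hK.isBounded.exists_norm_le
  have hR0 : 0 ≤ R := (norm_nonneg _).trans (hR _ hne.some_mem)
  obtain ⟨C, κ, hC0, hC⟩ := exists_norm_partialMask_le hM hM0
  have hC' := norm_infiniteMask_le hM hM0 hC
  -- A real infimum over an empty index set is 0 by convention, which would not be positive.
  have : Nonempty (((2 * Real.pi) • K : Set Plane)) := (hne.smul_set).to_subtype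
  have hD : 0 < C * (1 + R) ^ κ := by positivity
  refine lt_of_lt_of_le (show 0 < c / (C * (1 + R) ^ κ) ^ 2 by positivity)
    (le_ciInf fun ⟨k, ω, hω⟩ => ?_)
  obtain ⟨ξ, hξ, rfl⟩ := hω
  obtain ⟨j, hj⟩ : ∃ j, (k : ℕ) = j + 1 := ⟨k - 1, (Nat.sub_add_cancel k.pos).symm⟩
  have h1 : m (dilateInv k ((2 * Real.pi) • ξ))
      = rescaledMask m ((2 : ℝ)⁻¹ ^ (j + 1) • ξ) := by
    rw [rescaledMask, dilateInv, smul_comm, hj]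
  simp only [h1]
  rw [div_le_iff₀ (by positivity)]
  have h2 : infiniteMask (rescaledMask m) ξ = partialMask (rescaledMask m) j ξ *
      rescaledMask m ((2 : ℝ)⁻¹ ^ (j + 1) • ξ) *
      infiniteMask (rescaledMask m) ((2 : ℝ)⁻¹ ^ (j + 1) • ξ) := by
    rw [infiniteMask_eq_partialMask_mul hM hM0 (j + 1) ξ, partialMask, Finset.prod_range_succ,
      partialMask]
  have h3 : ‖(2 : ℝ)⁻¹ ^ (j + 1) • ξ‖ ≤ R := by
    rw [norm_half_pow_smul]
    exact (mul_le_of_le_one_left (norm_nonneg _)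
      (pow_le_one₀ (by norm_num) (by norm_num))).trans (hR ξ hξ)
  have h4 : ‖partialMask (rescaledMask m) j ξ‖ ≤ C * (1 + R) ^ κ :=
    (hC j ξ).trans (by have := hR ξ hξ; gcongr)
  have h5 : ‖infiniteMask (rescaledMask m) ((2 : ℝ)⁻¹ ^ (j + 1) • ξ)‖ ≤ C * (1 + R) ^ κ :=
    (hC' _).trans (by gcongr)
  refine (hc ξ hξ).trans ?_
  rw [h2, norm_mul, norm_mul]
  calc _ ≤ C * (1 + R) ^ κ * ‖rescaledMask m ((2 : ℝ)⁻¹ ^ (j + 1) • ξ)‖ *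
        (C * (1 + R) ^ κ) := by gcongr
    _ = _ := by ring

lemma card_shiftSet : shiftSet.card = 4 := by
  have hpi := Real.pi_ne_zero
  have key : ∀ a b c d : ℝ, (!₂[a, b] : Plane) = !₂[c, d] ↔ a = c ∧ b = d := fun a b c d =>
    ⟨fun h => ⟨by simpa using congrArg (fun v : Plane => v 0) h,
      by simpa using congrArg (fun v : Plane => v 1) h⟩, by rintro ⟨rfl, rfl⟩; rfl⟩
  rw [shiftSet, Finset.card_insert_of_notMem, Finset.card_insert_of_notMem,
    Finset.card_insert_of_notMem, Finset.card_singleton] <;>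
  simp [key, hpi, hpi.symm]

lemma two_smul_mem_lattice_of_mem_shiftSet {p : Plane} (hp : p ∈ shiftSet) :
    ∃ n, (2 : ℝ) • (2 * Real.pi)⁻¹ • p = latticeVec n := by
  have key : ∀ a b : ℤ, (2 : ℝ) • (2 * Real.pi)⁻¹ • (!₂[a * Real.pi, b * Real.pi] : Plane)
      = latticeVec ![a, b] := fun a b => by
    have hpi := Real.pi_ne_zero
    ext i
    fin_cases i <;> simp [latticeVec] <;> field_simp
  simp only [shiftSet, Finset.mem_insert, Finset.mem_singleton] at hp
  rcases hp with rfl | rfl | rfl | rfl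
  · exact ⟨_, by simpa using key 0 0⟩
  · exact ⟨_, by simpa using key 1 0⟩
  · exact ⟨_, by simpa using key 0 1⟩
  · exact ⟨_, by simpa using key 1 1⟩

/-- Biorthogonality forces the product of the two scaling functions not to vanish identically on
any coset of the lattice. -/
lemma BiorthogonalTranslates.exists_ne_zero {φ φ' : Lp ℂ 2 (volume : Measure Plane)}
    {m m' : Plane → ℂ} (hm : IsTrigPolynomial m) (hm' : IsTrigPolynomial m') (h0 : m 0 = 1)
    (h0' : m' 0 = 1) (hφ : HasRefinementMask φ m) (hφ' : HasRefinementMask φ' m')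
    (hb : BiorthogonalTranslates φ φ') (ξ : Plane) :
    ∃ n, infiniteMask (rescaledMask m) (ξ + latticeVec n) *
      infiniteMask (rescaledMask m') (ξ + latticeVec n) ≠ 0 := by
  obtain ⟨η, hη⟩ := exists_reproducing_infiniteMask hm.rescaledMask_mem (rescaledMask_zero h0)
  obtain ⟨η', hη'⟩ := exists_reproducing_infiniteMask hm'.rescaledMask_mem (rescaledMask_zero h0')
  have h1 := tsum_mul_conj_eq_one
    (continuous_infiniteMask hm.rescaledMask_mem (rescaledMask_zero h0))
    (continuous_infiniteMask hm'.rescaledMask_mem (rescaledMask_zero h0'))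
    hφ.memLp hφ'.memLp hη hη' ((biorthogonalTranslates_iff hφ hφ').1 hb) ξ
  by_contra! hz
  have h2 : ∀ n, infiniteMask (rescaledMask m) (ξ + latticeVec n) *
      conj (infiniteMask (rescaledMask m') (ξ + latticeVec n)) = 0 := fun n => by
    rcases mul_eq_zero.1 (hz n) with h | h <;> simp [h]
  simp [h2] at h1

open scoped Pointwise in
lemma exists_compact_of_biorthogonalTranslates {φ φ' : Lp ℂ 2 (volume : Measure Plane)}
    {m m' : Plane → ℂ} (hm : IsTrigPolynomial m) (hm' : IsTrigPolynomial m') (h0 : m 0 = 1)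
    (h0' : m' 0 = 1) (hφ : HasRefinementMask φ m) (hφ' : HasRefinementMask φ' m')
    (hb : BiorthogonalTranslates φ φ') :
    ∃ K : Set Plane, IsCompact K ∧ K ∈ 𝓝 (0 : Plane) ∧ CongruentToFreqSquare K ∧
      PosInfOn m K ∧ PosInfOn m' K := by
  have hH := continuous_infiniteMask hm.rescaledMask_mem (rescaledMask_zero h0)
  have hH' := continuous_infiniteMask hm'.rescaledMask_mem (rescaledMask_zero h0')
  obtain ⟨K, hKU, hKc, hK0, hcov, hvol⟩ := exists_compact_fundamentalDomain
    (U := {ξ | infiniteMask (rescaledMask m) ξ * infiniteMask (rescaledMask m') ξ ≠ 0})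
    ((hH.mul hH').isOpen_preimage _ isOpen_ne)
    (by simp [infiniteMask_zero (rescaledMask_zero h0), infiniteMask_zero (rescaledMask_zero h0')])
    (hb.exists_ne_zero hm hm' h0 h0' hφ hφ')
  have hne : K.Nonempty := ⟨0, mem_of_mem_nhds hK0⟩
  refine ⟨(2 * Real.pi) • K, hKc.smul _, (set_smul_mem_nhds_zero_iff two_pi_ne_zero).2 hK0,
    ⟨fun ω _ => ?_, ?_⟩,
    posInfOn_two_pi_smul hm h0 hKc hne fun ξ hξ => left_ne_zero_of_mul (hKU hξ),
    posInfOn_two_pi_smul hm' h0' hKc hne fun ξ hξ => right_ne_zero_of_mul (hKU hξ)⟩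
  · obtain ⟨n, hn⟩ := hcov ((2 * Real.pi)⁻¹ • ω)
    refine ⟨n, _, hn, ?_⟩
    simp only
    rw [smul_add, two_pi_smul_inv_smul]
  · rw [Measure.addHaar_smul, hvol, mul_one, volume_freqSquare, finrank_euclideanSpace_fin,
      abs_of_pos (by positivity)]

lemma biorthogonalTranslates_of_posInfOn {φ φ' : Lp ℂ 2 (volume : Measure Plane)}
    {m m' : Plane → ℂ} (hm : IsTrigPolynomial m) (hm' : IsTrigPolynomial m') (h0 : m 0 = 1)
    (h0' : m' 0 = 1) (hφ : HasRefinementMask φ m) (hφ' : HasRefinementMask φ' m')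
    (hsum : ∀ ω : Plane, ∑ p ∈ shiftSet, m (ω + p) * conj (m' (ω + p)) = 1) {K : Set Plane}
    (hcov : CoversFreqSquare K) (hK : PosInfOn m K) (hK' : PosInfOn m' K) :
    BiorthogonalTranslates φ φ' := by
  classical
  have hinj : Function.Injective fun p : Plane => (2 * Real.pi)⁻¹ • p :=
    smul_right_injective _ (inv_ne_zero two_pi_ne_zero)
  refine (biorthogonalTranslates_iff hφ hφ').2 (integral_infiniteMask_mul_conj
    (P := shiftSet.image fun p => (2 * Real.pi)⁻¹ • p)
    ((Finset.card_image_of_injective _ hinj).trans card_shiftSet) ?_ hm.rescaledMask_mem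
    hm'.rescaledMask_mem (rescaledMask_zero h0) (rescaledMask_zero h0') (fun ξ => ?_)
    hφ.memLp hφ'.memLp fun ξ => ?_)
  · intro _ hp
    obtain ⟨p, hp', rfl⟩ := Finset.mem_image.1 hp
    exact two_smul_mem_lattice_of_mem_shiftSet hp'
  · rw [Finset.sum_image fun _ _ _ _ h => hinj h, ← hsum ((2 * Real.pi) • ξ)]
    simp only [rescaledMask, smul_add, two_pi_smul_inv_smul]
  · obtain ⟨n, hn⟩ := hcov.exists_two_pi_smul_mem ξ
    exact ⟨n, mul_ne_zero (hK.infiniteMask_ne_zero hm h0 hn)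
      (hK'.infiniteMask_ne_zero hm' h0' hn)⟩

theorem mainTheorem4 (m₀ m₀' : Plane → ℂ)
    (hm : IsTrigPolynomial m₀) (hm' : IsTrigPolynomial m₀')
    (h0 : m₀ 0 = 1) (h0' : m₀' 0 = 1)
    (φ φ' : Lp ℂ 2 (volume : Measure Plane))
    (hφ : HasRefinementMask φ m₀) (hφ' : HasRefinementMask φ' m₀') :
    (BiorthogonalTranslates φ φ' →
      ∃ K : Set Plane, IsCompact K ∧ K ∈ 𝓝 (0 : Plane) ∧ CongruentToFreqSquare K ∧
        PosInfOn m₀ K ∧ PosInfOn m₀' K) ∧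
    ((∀ ω : Plane, ∑ p ∈ shiftSet, m₀ (ω + p) * conj (m₀' (ω + p)) = 1) →
      (∃ K : Set Plane, K ∈ 𝓝 (0 : Plane) ∧ CoversFreqSquare K ∧
        PosInfOn m₀ K ∧ PosInfOn m₀' K) →
      BiorthogonalTranslates φ φ') := by
  refine ⟨exists_compact_of_biorthogonalTranslates hm hm' h0 h0' hφ hφ', ?_⟩
  rintro hsum ⟨K, -, hcov, hK, hK'⟩
  exact biorthogonalTranslates_of_posInfOn hm hm' h0 h0' hφ hφ' hsum hcov hK hK'
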